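/- A weighted graph is a finite simple graph $G$ together with a positive real weight on each edge. Its adjacency matrix has as $(i,j)$ entry the weight of the edge $v_iv_j$ if $v_iv_j$ is an edge, and $0$ otherwise. Let $i_-(G_w)$ be the number of negative eigenvalues of this matrix, counted with multiplicity. A bicyclic graph is a connected simple graph whose number of edges is its number of vertices plus $1$. A pendant is a vertex of degree $1$. Isomorphisms of weighted graphs preserve edge weights. For $p,l,q\ge 0$, at most one of them $0$, let $\theta(p,l,q)_w$ be a weighted graph formed by three paths with $p$, $l$ and $q$ inner vertices respectively, which share their initial vertex $u$ and their terminal vertex $v$ and are otherwise disjoint. The edge weights along these paths, read from $u$ to $v$, are $a_1,\dots,a_{p+1}$, then $b_1,\dots,b_{l+1}$, and $c_1,\dots,c_{q+1}$. Let $\infty(4,1,4)_w$ be a weighted graph formed by two $4$-cycles that share exactly one vertex $v$. The edge weights around the two cycles, read cyclically from $v$, are $a_1,a_2,a_3,a_4$ and $b_1,b_2,b_3,b_4$. All weights are positive. **Theorem 4.5.** Let $G_w$ be a weighted bicyclic graph without pendants. Then $i_-(G_w)=2$ if and only if $G_w$ is isomorphic, as a weighted graph, to one of the following, for some positive weights satisfying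 the stated condition: 1. $\infty(4,1,4)_w$ with $a_1a_3=a_2a_4$ and $b_1b_3=b_2b_4$; 2. $\theta(1,1,1)_w$ with $a_2b_1\neq a_1b_2$ or $a_2c_1\neq a_1c_2$; 3. $\theta(1,0,1)_w$, with no condition on the weights; 4. $\theta(1,0,2)_w$ with $b_1c_2\le c_1c_3$; 5. $\theta(2,0,2)_w$ with $a_2b_1c_2-a_1a_3c_2-a_2c_1c_3=0$; 6. $\theta(1,1,2)_w$ with $a_1b_2=a_2b_1$. -/

import Mathlib

/-- Positive real numbers, the admissible edge weights. -/
abbrev PosReal : Type := {r : ℝ // 0 < r}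

/-- A simple graph with positive edge weights. Only the values of `weight` on edges are relevant:
the adjacency matrix and isomorphisms below ignore the values on pairs that are not edges. -/
structure WeightedGraph (V : Type*) where
  graph : SimpleGraph V
  weight : Sym2 V → ℝ
  weight_pos : ∀ e ∈ graph.edgeSet, 0 < weight e

namespace WeightedGraph

/-- Isomorphism of weighted graphs: a graph isomorphism that preserves the weight of every edge. -/
def Isomorphic {V W : Type*} (G : WeightedGraph V) (H : WeightedGraph W) : Prop :=
  ∃ φ : G.graph ≃g H.graph,
    ∀ x y : V, G.graph.Adj x y → H.weight s(φ x, φ y) = G.weight s(x, y)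

open Classical in
/-- The weighted adjacency matrix. -/
noncomputable def adjMatrix {V : Type*} (G : WeightedGraph V) : Matrix V V ℝ :=
  Matrix.of fun x y => if G.graph.Adj x y then G.weight s(x, y) else 0

theorem isHermitian_adjMatrix {V : Type*} (G : WeightedGraph V) : G.adjMatrix.IsHermitian := by
  ext x y
  have h : s(y, x) = s(x, y) := Sym2.eq_swap
  by_cases hxy : G.graph.Adj x y
  · simp [adjMatrix, hxy, hxy.symm, h]
  · have hyx : ¬ G.graph.Adj y x := fun h' => hxy h'.symm
    simp [adjMatrix, hxy, hyx]

/-- The negative index of inertia: the number of negative eigenvalues of the adjacency matrix,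
counted with multiplicity. -/
noncomputable def negIndex {V : Type*} [Fintype V] [DecidableEq V] (G : WeightedGraph V) : ℕ :=
  (Finset.univ.filter fun i : V => G.isHermitian_adjMatrix.eigenvalues i < 0).card

/-- The underlying graph is bicyclic: connected, with one more edge than vertices. -/
def IsBicyclic {V : Type*} (G : WeightedGraph V) : Prop :=
  G.graph.Connected ∧ G.graph.edgeSet.ncard = Nat.card V + 1

/-- The graph has a pendant vertex, that is, a vertex of degree one. -/
def HasPendant {V : Type*} (G : WeightedGraph V) : Prop :=
  ∃ v : V, (G.graph.neighborSet v).ncard = 1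

/-- The weighted graph on `V` whose edges are the (pairwise distinct, non-loop) pairs `ends k`,
the edge `ends k` having weight `w k`. -/
def ofEdges {V ι : Type*} [DecidableEq V] [Fintype ι] (ends : ι → Sym2 V) (w : ι → PosReal) :
    WeightedGraph V where
  graph := SimpleGraph.fromEdgeSet (Set.range ends)
  weight e := ∑ k ∈ Finset.univ.filter (fun k => ends k = e), (w k : ℝ)
  weight_pos := by
    intro e he
    rw [SimpleGraph.edgeSet_fromEdgeSet] at he
    obtain ⟨k, rfl⟩ := he.1
    exact Finset.sum_pos (fun i _ => (w i).2) ⟨k, by simp⟩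

/-- The `k`-th vertex of the path `x, f 0, …, f (n - 1), y`, counted from `0`
(so `x` is number `0` and `y` is number `n + 1`). With `x = y` this is a cycle of length `n + 1`. -/
def pathVertex {V : Type*} {n : ℕ} (x y : V) (f : Fin n → V) (k : ℕ) : V :=
  if k = 0 then x else if h : k - 1 < n then f ⟨k - 1, h⟩ else y

/-- The weighted graph `θ(p, l, q)` (at most one of `p, l, q` is zero): three paths with `p`, `l`
and `q` inner vertices that share their initial vertex `u = inl false` and their terminal vertex
`v = inl true`. Along the three paths, from `u` to `v`, the edge weights are
`a 0, …, a p`, then `b 0, …, b l`, and `c 0, …, c q`. -/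
def theta (p l q : ℕ) (a : Fin (p + 1) → PosReal) (b : Fin (l + 1) → PosReal)
    (c : Fin (q + 1) → PosReal) : WeightedGraph (Bool ⊕ Fin p ⊕ Fin l ⊕ Fin q) :=
  let path {n : ℕ} (f : Fin n → Bool ⊕ Fin p ⊕ Fin l ⊕ Fin q) (k : ℕ) :=
    pathVertex (Sum.inl false) (Sum.inl true) f k
  let A := path fun i => Sum.inr (Sum.inl i)
  let B := path fun i => Sum.inr (Sum.inr (Sum.inl i))
  let C := path fun i => Sum.inr (Sum.inr (Sum.inr i))
  ofEdges (ι := Fin (p + 1) ⊕ Fin (l + 1) ⊕ Fin (q + 1))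
    (Sum.elim (fun k => s(A k, A (k + 1)))
      (Sum.elim (fun k => s(B k, B (k + 1))) (fun k => s(C k, C (k + 1)))))
    (Sum.elim a (Sum.elim b c))

/-- The weighted graph `∞(p, l, q)` (`p, q ≥ 3`, `l ≥ 1`): a path with `l` vertices, a cycle of
length `p` through its first vertex and a cycle of length `q` through its last vertex (the same
vertex if `l = 1`). The edge weights are `a 0, …, a (p - 1)` around the first cycle and
`b 0, …, b (q - 1)` around the second, each starting at the vertex on the path, and
`c 0, …, c (l - 2)` along the path. -/
def infty (p l q : ℕ) [NeZero l] (a : Fin p → PosReal) (b : Fin q → PosReal)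
    (c : Fin (l - 1) → PosReal) : WeightedGraph (Fin l ⊕ Fin (p - 1) ⊕ Fin (q - 1)) :=
  let P (k : ℕ) : Fin l ⊕ Fin (p - 1) ⊕ Fin (q - 1) := Sum.inl (Fin.ofNat l k)
  let A := pathVertex (P 0) (P 0) fun i => Sum.inr (Sum.inl i)
  let B := pathVertex (P (l - 1)) (P (l - 1)) fun i => Sum.inr (Sum.inr i)
  ofEdges (ι := Fin p ⊕ Fin q ⊕ Fin (l - 1))
    (Sum.elim (fun k => s(A k, A (k + 1)))
      (Sum.elim (fun k => s(B k, B (k + 1))) (fun k => s(P k, P (k + 1)))))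
    (Sum.elim a (Sum.elim b c))

end WeightedGraph

/-! In an eigenvector basis, the negative index is controlled by subspaces. A `k`-dimensional space
on which the quadratic form of the adjacency matrix `A` is nonpositive, and which meets `ker A`
trivially, gives at least `k` (`le_negIndex_of_form_nonpos`). Nonnegativity on the common zeros of
`k` functionals gives at most `k` (`negIndex_le_of_form_nonneg`).

Shape: the excesses `deg - 2` sum to `2`, so there is one vertex of degree four or there are two of
degree three, and all others have degree two (`IsBicyclic.degrees`). The neighbourhoods are followed
outwards from these branch vertices. Index below three excludes a few local configurations, each
with three independent nonpositive directions: three pairwise nonadjacent vertices whose adjacency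
to three others is triangular or hexagonal, a triangle with an edge whose far end does not touch it,
and a bowtie. What survives closes up into one of six shapes, and connectedness with the edge count
yields the isomorphism (`isomorphic_ofEdges`).

Weights: in the bipartite shapes θ(1,1,1) and ∞(4,1,4) the index is the rank of the biadjacency
matrix. Elsewhere Schur complements decide. Splitting off the middle edge of a path with two inner
vertices and weights `c₁, c₂, c₃` costs one negative eigenvalue and adds `-c₁c₃/c₂` to the weight of
`uv`. So θ(1,0,2) reduces to a triangle, where the sign of the new weight matters, and θ(2,0,2) to a
single edge, whose weight must vanish. In θ(1,1,2) the two vertices of degree two with common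
neighbours must have proportional columns; they then count as one, as in θ(1,0,2) with `b₁ = 0`. -/

namespace WeightedGraph

open Matrix

/-! ### Variational bounds for the negative index -/

section Inertia

variable {V : Type*} [Fintype V] [DecidableEq V] (G : WeightedGraph V)

/-- The bilinear form of the weighted adjacency matrix. -/
noncomputable def form (x y : V → ℝ) : ℝ := x ⬝ᵥ (G.adjMatrix *ᵥ y)

/-- The coordinates of `x` in the eigenvector basis. -/
noncomputable def eigenCoord : (V → ℝ) →ₗ[ℝ] (V → ℝ) :=
  (star (G.isHermitian_adjMatrix.eigenvectorUnitary : Matrix V V ℝ)).mulVecLin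

theorem mulVec_eq_eigenCoord (x : V → ℝ) :
    G.adjMatrix *ᵥ x = (G.isHermitian_adjMatrix.eigenvectorUnitary : Matrix V V ℝ) *ᵥ
      fun i => G.isHermitian_adjMatrix.eigenvalues i * G.eigenCoord x i := by
  conv_lhs => rw [G.isHermitian_adjMatrix.spectral_theorem]
  rw [Unitary.conjStarAlgAut_apply, ← mulVec_mulVec, ← mulVec_mulVec]
  congr 1
  ext i
  simp [mulVec_diagonal, eigenCoord]

theorem form_self_eq_sum (x : V → ℝ) :
    G.form x x = ∑ i, G.isHermitian_adjMatrix.eigenvalues i * G.eigenCoord x i ^ 2 := by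
  rw [form, mulVec_eq_eigenCoord, dotProduct_mulVec]
  simp only [dotProduct]
  refine Finset.sum_congr rfl fun i _ => ?_
  have : (x ᵥ* (G.isHermitian_adjMatrix.eigenvectorUnitary : Matrix V V ℝ)) i
      = G.eigenCoord x i := by
    simp [eigenCoord, star_eq_conjTranspose, conjTranspose_eq_transpose_of_trivial]
  rw [this]
  ring

theorem eigenCoord_mulVec (d : V → ℝ) :
    G.eigenCoord ((G.isHermitian_adjMatrix.eigenvectorUnitary : Matrix V V ℝ) *ᵥ d) = d := by
  simp [eigenCoord]

/-- A `k`-dimensional space on which the form is nonpositive and which meets the kernel of the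
adjacency matrix trivially shows that the negative index is at least `k`. -/
theorem le_negIndex_of_form_nonpos {k : ℕ} (g : (Fin k → ℝ) →ₗ[ℝ] (V → ℝ))
    (hg : ∀ c, G.form (g c) (g c) ≤ 0) (hker : ∀ c, (∀ y, G.form y (g c) = 0) → c = 0) :
    k ≤ G.negIndex := by
  by_contra! hlt
  -- `T` keeps the coordinates at negative eigenvalues. These are fewer than `k`, so some nonzero
  -- `c` loses all of them.
  let T : (Fin k → ℝ) →ₗ[ℝ]
      ({i // G.isHermitian_adjMatrix.eigenvalues i < 0} → ℝ) :=
    (LinearMap.funLeft ℝ ℝ Subtype.val) ∘ₗ G.eigenCoord ∘ₗ g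
  have hT : LinearMap.ker T ≠ ⊥ := by
    apply LinearMap.ker_ne_bot_of_finrank_lt
    simpa [negIndex, Fintype.card_subtype] using hlt
  obtain ⟨c, hc, hc0⟩ := (Submodule.ne_bot_iff _).1 hT
  have hz : ∀ i, G.isHermitian_adjMatrix.eigenvalues i < 0 → G.eigenCoord (g c) i = 0 := by
    intro i hi
    simpa [T] using congrFun (LinearMap.mem_ker.1 hc) ⟨i, hi⟩
  have hnn : ∀ i ∈ Finset.univ,
      0 ≤ G.isHermitian_adjMatrix.eigenvalues i * G.eigenCoord (g c) i ^ 2 := by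
    intro i _
    rcases lt_or_ge (G.isHermitian_adjMatrix.eigenvalues i) 0 with h | h
    · simp [hz i h]
    · positivity
  have hsum := hg c
  rw [form_self_eq_sum] at hsum
  -- The nonnegative terms have a nonpositive sum, so each vanishes; hence `A` kills `g c`.
  have h0 := (Finset.sum_eq_zero_iff_of_nonneg hnn).1 (le_antisymm hsum (Finset.sum_nonneg hnn))
  refine hc0 (hker c fun y => ?_)
  have : (fun i => G.isHermitian_adjMatrix.eigenvalues i * G.eigenCoord (g c) i) = 0 := by
    ext i
    have := h0 i (Finset.mem_univ i)
    simpa using this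
  rw [form, mulVec_eq_eigenCoord, this]
  simp

theorem le_negIndex_of_form_neg {k : ℕ} (g : (Fin k → ℝ) →ₗ[ℝ] (V → ℝ))
    (hg : ∀ c, 0 ≤ G.form (g c) (g c) → c = 0) : k ≤ G.negIndex :=
  G.le_negIndex_of_form_nonpos g (fun c => by
    by_contra! h
    simp [hg c h.le, form] at h) fun c hc => hg c (hc _).ge

/-- If the form is nonnegative on the common kernel of `k` functionals, then the negative index
is at most `k`. -/
theorem negIndex_le_of_form_nonneg {k : ℕ} (f : (V → ℝ) →ₗ[ℝ] (Fin k → ℝ))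
    (hf : ∀ x, f x = 0 → 0 ≤ G.form x x) : G.negIndex ≤ k := by
  by_contra! hlt
  let S := {i // G.isHermitian_adjMatrix.eigenvalues i < 0}
  -- `T` parametrizes the span of the negative eigenvectors, whose dimension exceeds `k`, so `f`
  -- vanishes at a nonzero vector of it.
  let T : (S → ℝ) →ₗ[ℝ] (V → ℝ) :=
    (G.isHermitian_adjMatrix.eigenvectorUnitary : Matrix V V ℝ).mulVecLin ∘ₗ
      Function.ExtendByZero.linearMap ℝ Subtype.val
  have hT : LinearMap.ker (f ∘ₗ T) ≠ ⊥ := by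
    apply LinearMap.ker_ne_bot_of_finrank_lt
    simpa [negIndex, S, Fintype.card_subtype] using hlt
  obtain ⟨d, hd, hd0⟩ := (Submodule.ne_bot_iff _).1 hT
  have hq := hf (T d) (by simpa using hd)
  have hcoord : G.eigenCoord (T d) = Function.extend Subtype.val d 0 := by
    simp [T, eigenCoord_mulVec]
    rfl
  rw [form_self_eq_sum, hcoord] at hq
  obtain ⟨s, hs⟩ := Function.ne_iff.1 hd0
  refine absurd hq (not_le.2 (Finset.sum_neg' (fun i _ => ?_) ⟨s.1, Finset.mem_univ _, ?_⟩))
  · by_cases hi : G.isHermitian_adjMatrix.eigenvalues i < 0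
    · exact mul_nonpos_of_nonpos_of_nonneg hi.le (sq_nonneg _)
    · rw [Function.extend_apply']
      · simp
      · rintro ⟨a, rfl⟩
        exact hi a.2
  · rw [Subtype.val_injective.extend_apply]
    have h1 : G.isHermitian_adjMatrix.eigenvalues s.1 < 0 := s.2
    have h2 : d s ≠ 0 := by simpa using hs
    exact mul_neg_of_neg_of_pos h1 (by positivity)

omit [DecidableEq V] in
theorem form_eq_sum (x y : V → ℝ) :
    G.form x y = ∑ i, ∑ j, x i * G.adjMatrix i j * y j := by
  simp only [form, dotProduct, mulVec, Finset.mul_sum, mul_assoc]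

/-- The vector with the coordinates `c i` at the vertices `φ i`. -/
noncomputable def spread {m : ℕ} (φ : Fin m → V) : (Fin m → ℝ) →ₗ[ℝ] (V → ℝ) :=
  ∑ i, (LinearMap.single ℝ (fun _ : V => ℝ) (φ i)) ∘ₗ LinearMap.proj i

/-- Bilinearity alone is used, so `φ` may repeat vertices, and the obstructions below need no
distinctness hypotheses. -/
theorem form_spread {m : ℕ} (φ : Fin m → V) (x y : Fin m → ℝ) :
    G.form (spread φ x) (spread φ y) = ∑ i, ∑ j, x i * G.adjMatrix (φ i) (φ j) * y j := by
  have h (x : Fin m → ℝ) : spread φ x = ∑ i, x i • Pi.single (φ i) (1 : ℝ) := by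
    simp only [spread, LinearMap.sum_apply]
    refine Finset.sum_congr rfl fun i _ => ?_
    ext v
    simp [Pi.single_apply]
  rw [form, h, h, sum_dotProduct]
  refine Finset.sum_congr rfl fun i _ => ?_
  rw [mulVec_sum, dotProduct_sum]
  refine Finset.sum_congr rfl fun j _ => ?_
  simp [mulVec_smul, mul_comm, mul_left_comm]

/-- The lower bound for the negative index, from a space of vectors supported on the vertices
`φ i`. -/
theorem le_negIndex_of_spread {k m : ℕ} (φ : Fin m → V) (g : (Fin k → ℝ) →ₗ[ℝ] (Fin m → ℝ))
    (hg : ∀ c, ∑ i, ∑ j, g c i * G.adjMatrix (φ i) (φ j) * g c j ≤ 0)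
    (hker : ∀ c, (∀ y : Fin m → ℝ, ∑ i, ∑ j, y i * G.adjMatrix (φ i) (φ j) * g c j = 0) → c = 0) :
    k ≤ G.negIndex := by
  refine G.le_negIndex_of_form_nonpos (spread φ ∘ₗ g) (fun c => ?_) fun c hc => hker c fun y => ?_
  · simpa [form_spread] using hg c
  · simpa [form_spread] using hc (spread φ y)

end Inertia

/-! ### Invariance under isomorphism -/

section Isomorphism

variable {V W : Type*} [Fintype V] [DecidableEq V] [Fintype W] [DecidableEq W]

theorem Isomorphic.exists_equiv_adjMatrix {V W : Type*} {G : WeightedGraph V}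
    {H : WeightedGraph W} (h : G.Isomorphic H) :
    ∃ e : V ≃ W, ∀ x y, H.adjMatrix (e x) (e y) = G.adjMatrix x y := by
  obtain ⟨φ, hφ⟩ := h
  refine ⟨φ.toEquiv, fun x y => ?_⟩
  by_cases hxy : G.graph.Adj x y
  · simpa [adjMatrix, hxy, φ.map_rel_iff.2 hxy] using hφ x y hxy
  · have hxy' : ¬ H.graph.Adj (φ x) (φ y) := fun h => hxy (φ.map_rel_iff.1 h)
    simp [adjMatrix, hxy, hxy']

/-- Relabelling the vertices preserves the characteristic polynomial, whose roots with multiplicity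
are the eigenvalues. -/
theorem Isomorphic.negIndex_eq {G : WeightedGraph V} {H : WeightedGraph W}
    (h : G.Isomorphic H) : G.negIndex = H.negIndex := by
  obtain ⟨e, he⟩ := h.exists_equiv_adjMatrix
  have hform (x y : W → ℝ) : G.form (x ∘ e) (y ∘ e) = H.form x y := by
    rw [form_eq_sum, form_eq_sum, ← e.sum_comp]
    refine Finset.sum_congr rfl fun i _ => ?_
    rw [← e.sum_comp]
    simp [he]
  have hpoly : H.adjMatrix = G.adjMatrix.submatrix e.symm e.symm := by
    ext x y
    simp [← he]
  have hchar : G.adjMatrix.charpoly = H.adjMatrix.charpoly := by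
    rw [hpoly, ← charpoly_reindex e G.adjMatrix]
    rfl
  have hroots := congrArg Polynomial.roots hchar
  rw [G.isHermitian_adjMatrix.roots_charpoly_eq_eigenvalues,
    H.isHermitian_adjMatrix.roots_charpoly_eq_eigenvalues] at hroots
  have := congrArg (Multiset.countP (fun r : ℝ => r < 0)) hroots
  simpa [negIndex, Multiset.countP_map, Finset.card_def, Finset.filter_val] using this

end Isomorphism

/-! ### The form of a graph given by a list of edges -/

section Edges

variable {V ι : Type*} [Fintype V] [DecidableEq V] [Fintype ι]

omit [Fintype V] in
theorem adjMatrix_ofEdges (s t : ι → V) (hst : ∀ k, s k ≠ t k) (w : ι → PosReal) (x y : V) :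
    (ofEdges (fun k => s(s k, t k)) w).adjMatrix x y =
      ∑ k, ((if s k = x ∧ t k = y then (w k : ℝ) else 0) +
        if s k = y ∧ t k = x then (w k : ℝ) else 0) := by
  classical
  -- Since `s k ≠ t k`, the two orientations cannot both match, unless neither does, so the
  -- indicators add up to that of the unordered pair.
  have hterm (k : ι) : ((if s k = x ∧ t k = y then (w k : ℝ) else 0) +
      if s k = y ∧ t k = x then (w k : ℝ) else 0) =
      if s(s k, t k) = s(x, y) then (w k : ℝ) else 0 := by
    have := hst k
    by_cases h1 : s k = x ∧ t k = y
    · obtain ⟨rfl, rfl⟩ := h1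
      simp [this]
    · by_cases h2 : s k = y ∧ t k = x
      · obtain ⟨rfl, rfl⟩ := h2
        simp [this, this.symm]
      · simp [h1, h2]
  simp only [hterm, adjMatrix, ofEdges, SimpleGraph.fromEdgeSet_adj, Set.mem_range, of_apply]
  split_ifs with h
  · rw [Finset.sum_filter]
  · refine (Finset.sum_eq_zero fun k _ => if_neg fun hk => h ⟨⟨k, hk⟩, ?_⟩).symm
    rintro rfl
    have := hst k
    simp_all

theorem form_ofEdges (s t : ι → V) (hst : ∀ k, s k ≠ t k) (w : ι → PosReal) (x y : V → ℝ) :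
    (ofEdges (fun k => s(s k, t k)) w).form x y =
      ∑ k, (w k : ℝ) * (x (s k) * y (t k) + x (t k) * y (s k)) := by
  simp only [form_eq_sum, adjMatrix_ofEdges s t hst, Finset.mul_sum, Finset.sum_mul]
  have hswap (i : V) : ∑ j, ∑ k, x i * ((if s k = i ∧ t k = j then (w k : ℝ) else 0) +
      if s k = j ∧ t k = i then (w k : ℝ) else 0) * y j = ∑ k, ∑ j, x i *
        ((if s k = i ∧ t k = j then (w k : ℝ) else 0) +
      if s k = j ∧ t k = i then (w k : ℝ) else 0) * y j := Finset.sum_comm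
  simp only [hswap]
  rw [Finset.sum_comm]
  refine Finset.sum_congr rfl fun k _ => ?_
  simp only [mul_add, add_mul, Finset.sum_add_distrib, ite_and, mul_ite, ite_mul, mul_zero,
    zero_mul, Finset.sum_ite_eq, Finset.sum_ite_irrel, Finset.sum_const_zero, Finset.mem_univ,
    if_true]
  ring

end Edges

/-! ### Local configurations that bound the index from below -/

section Obstructions

variable {V : Type*} [Fintype V] [DecidableEq V] (G : WeightedGraph V)

omit [Fintype V] [DecidableEq V] in
theorem adjMatrix_eq_zero {x y : V} (h : ¬ G.graph.Adj x y) : G.adjMatrix x y = 0 := by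
  simp [adjMatrix, h]

omit [Fintype V] [DecidableEq V] in
theorem adjMatrix_pos {x y : V} (h : G.graph.Adj x y) : 0 < G.adjMatrix x y := by
  simpa [adjMatrix, h] using G.weight_pos _ ((SimpleGraph.mem_edgeSet _).2 h)

omit [Fintype V] [DecidableEq V] in
theorem adjMatrix_comm (x y : V) : G.adjMatrix x y = G.adjMatrix y x := by
  simpa using (G.isHermitian_adjMatrix.apply x y).symm

/-- Vertices `φ i` that are pairwise nonadjacent, and for which the corresponding columns of the
adjacency matrix are independent, bound the negative index from below. -/
theorem le_negIndex_of_isotropic {k : ℕ} (φ : Fin k → V)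
    (hind : ∀ i j, G.adjMatrix (φ i) (φ j) = 0)
    (hker : ∀ c : Fin k → ℝ, (∀ v, ∑ i, G.adjMatrix v (φ i) * c i = 0) → c = 0) :
    k ≤ G.negIndex := by
  refine G.le_negIndex_of_form_nonpos (spread φ) (fun c => ?_) fun c hc => hker c fun v => ?_
  · simp [form_spread, hind]
  · have h2 := hc (Pi.single v 1)
    rw [form, single_one_dotProduct] at h2
    rw [← h2]
    simp only [mulVec, dotProduct, spread, LinearMap.sum_apply, Finset.sum_apply, Finset.mul_sum]
    rw [Finset.sum_comm]
    refine Finset.sum_congr rfl fun i _ => ?_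
    simp [Pi.single_apply]

theorem two_le_negIndex_of_triangular {x₁ x₂ y₁ y₂ : V} (hx : ¬ G.graph.Adj x₁ x₂)
    (h₁ : G.graph.Adj x₁ y₁) (h₂ : G.graph.Adj x₂ y₂) (h₁₂ : ¬ G.graph.Adj x₁ y₂) :
    2 ≤ G.negIndex := by
  refine G.le_negIndex_of_isotropic ![x₁, x₂] (fun i j => ?_) fun c hc => ?_
  · apply G.adjMatrix_eq_zero
    fin_cases i <;> fin_cases j <;> simp [hx, mt SimpleGraph.Adj.symm hx]
  · have e₂ := hc y₂
    have e₁ := hc y₁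
    simp only [Fin.sum_univ_two, cons_val_zero, cons_val_one] at e₁ e₂
    rw [G.adjMatrix_comm y₂ x₁, G.adjMatrix_eq_zero h₁₂] at e₂
    have c1 : c 1 = 0 := by simpa [(G.adjMatrix_pos h₂.symm).ne'] using e₂
    have c0 : c 0 = 0 := by simpa [(G.adjMatrix_pos h₁.symm).ne', c1] using e₁
    ext i
    fin_cases i <;> simp [c0, c1]

/-- The rows `yᵢ` and columns `xⱼ` of `A` form a triangular matrix with positive diagonal, so the
columns are independent. Adjacencies among the `yᵢ`, and between `xⱼ` and `yᵢ` for `i < j`, are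
free, which makes this the main tool of the classification. -/
theorem three_le_negIndex_of_triangular {x₁ x₂ x₃ y₁ y₂ y₃ : V}
    (hx₁₂ : ¬ G.graph.Adj x₁ x₂) (hx₁₃ : ¬ G.graph.Adj x₁ x₃) (hx₂₃ : ¬ G.graph.Adj x₂ x₃)
    (h₁ : G.graph.Adj x₁ y₁) (h₂ : G.graph.Adj x₂ y₂) (h₃ : G.graph.Adj x₃ y₃)
    (h₁₂ : ¬ G.graph.Adj x₁ y₂) (h₁₃ : ¬ G.graph.Adj x₁ y₃) (h₂₃ : ¬ G.graph.Adj x₂ y₃) :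
    3 ≤ G.negIndex := by
  refine G.le_negIndex_of_isotropic ![x₁, x₂, x₃] (fun i j => ?_) fun c hc => ?_
  · apply G.adjMatrix_eq_zero
    fin_cases i <;> fin_cases j <;> simp [hx₁₂, hx₁₃, hx₂₃, mt SimpleGraph.Adj.symm hx₁₂,
      mt SimpleGraph.Adj.symm hx₁₃, mt SimpleGraph.Adj.symm hx₂₃]
  · have e₃ := hc y₃
    have e₂ := hc y₂
    have e₁ := hc y₁
    simp only [Fin.sum_univ_three, cons_val_zero, cons_val_one, cons_val_two, tail_cons,
      head_cons] at e₁ e₂ e₃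
    rw [G.adjMatrix_comm y₂ x₁, G.adjMatrix_eq_zero h₁₂] at e₂
    rw [G.adjMatrix_comm y₃ x₁, G.adjMatrix_eq_zero h₁₃, G.adjMatrix_comm y₃ x₂,
      G.adjMatrix_eq_zero h₂₃] at e₃
    have c2 : c 2 = 0 := by simpa [(G.adjMatrix_pos h₃.symm).ne'] using e₃
    have c1 : c 1 = 0 := by simpa [(G.adjMatrix_pos h₂.symm).ne', c2] using e₂
    have c0 : c 0 = 0 := by simpa [(G.adjMatrix_pos h₁.symm).ne', c1, c2] using e₁
    ext i
    fin_cases i <;> simp [c0, c1, c2]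

/-- An induced hexagon `x₁ y₁ x₂ y₂ x₃ y₃`. -/
theorem three_le_negIndex_of_hexagon {x₁ x₂ x₃ y₁ y₂ y₃ : V}
    (hx₁₂ : ¬ G.graph.Adj x₁ x₂) (hx₁₃ : ¬ G.graph.Adj x₁ x₃) (hx₂₃ : ¬ G.graph.Adj x₂ x₃)
    (h₁₁ : G.graph.Adj x₁ y₁) (h₂₁ : G.graph.Adj x₂ y₁) (h₂₂ : G.graph.Adj x₂ y₂)
    (h₃₂ : G.graph.Adj x₃ y₂) (h₃₃ : G.graph.Adj x₃ y₃) (h₁₃ : G.graph.Adj x₁ y₃)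
    (h₁₂ : ¬ G.graph.Adj x₁ y₂) (h₂₃ : ¬ G.graph.Adj x₂ y₃) (h₃₁ : ¬ G.graph.Adj x₃ y₁) :
    3 ≤ G.negIndex := by
  refine G.le_negIndex_of_isotropic ![x₁, x₂, x₃] (fun i j => ?_) fun c hc => ?_
  · apply G.adjMatrix_eq_zero
    fin_cases i <;> fin_cases j <;> simp [hx₁₂, hx₁₃, hx₂₃, mt SimpleGraph.Adj.symm hx₁₂,
      mt SimpleGraph.Adj.symm hx₁₃, mt SimpleGraph.Adj.symm hx₂₃]
  · have e₃ := hc y₃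
    have e₂ := hc y₂
    have e₁ := hc y₁
    simp only [Fin.sum_univ_three, cons_val_zero, cons_val_one, cons_val_two, tail_cons,
      head_cons] at e₁ e₂ e₃
    rw [G.adjMatrix_comm y₁ x₃, G.adjMatrix_eq_zero h₃₁] at e₁
    rw [G.adjMatrix_comm y₂ x₁, G.adjMatrix_eq_zero h₁₂] at e₂
    rw [G.adjMatrix_comm y₃ x₂, G.adjMatrix_eq_zero h₂₃] at e₃
    have p₁₁ := G.adjMatrix_pos h₁₁.symm
    have p₂₁ := G.adjMatrix_pos h₂₁.symm
    have p₂₂ := G.adjMatrix_pos h₂₂.symm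
    have p₃₂ := G.adjMatrix_pos h₃₂.symm
    have p₃₃ := G.adjMatrix_pos h₃₃.symm
    have p₁₃ := G.adjMatrix_pos h₁₃.symm
    have c0 : c 0 = 0 := by
      -- Cramer's rule. A 3-cycle is an even permutation, so both terms of the determinant are
      -- positive whatever the weights.
      have hdet : (G.adjMatrix y₁ x₁ * G.adjMatrix y₂ x₂ * G.adjMatrix y₃ x₃ +
          G.adjMatrix y₁ x₂ * G.adjMatrix y₂ x₃ * G.adjMatrix y₃ x₁) * c 0 = 0 := by
        linear_combination G.adjMatrix y₂ x₂ * G.adjMatrix y₃ x₃ * e₁ -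
          G.adjMatrix y₁ x₂ * G.adjMatrix y₃ x₃ * e₂ + G.adjMatrix y₁ x₂ * G.adjMatrix y₂ x₃ * e₃
      rcases mul_eq_zero.1 hdet with h | h
      · exact absurd h (by positivity)
      · exact h
    have c1 : c 1 = 0 := by simpa [p₂₁.ne', c0] using e₁
    have c2 : c 2 = 0 := by simpa [p₃₃.ne', c0] using e₃
    ext i
    fin_cases i <;> simp [c0, c1, c2]

/-- The quadratic form of a triangle with edge weights `α, β, γ`, where `α` is opposite to the
third vertex, is negative at this vector unless `s = r = 0`. -/
theorem triangle_form {α : ℝ} (hα : α ≠ 0) (β γ s r : ℝ) :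
    α * ((s - β / α * r) * (-s - γ / α * r)) + γ * ((s - β / α * r) * r) +
      β * ((-s - γ / α * r) * r) = -(α * s ^ 2 + β * γ / α * r ^ 2) := by
  field_simp
  ring

theorem two_le_negIndex_of_triangle {a b c : V} (hab : G.graph.Adj a b) (hbc : G.graph.Adj b c)
    (hca : G.graph.Adj c a) : 2 ≤ G.negIndex := by
  have pab := G.adjMatrix_pos hab
  have pbc := G.adjMatrix_pos hbc
  have pca := G.adjMatrix_pos hca
  -- The columns are the negative direction of the edge `ab`, and the vector with entry `1` at `c`
  -- that is `A`-orthogonal to `a` and `b`.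
  let g : (Fin 2 → ℝ) →ₗ[ℝ] (Fin 3 → ℝ) :=
    Matrix.mulVecLin !![1, -(G.adjMatrix b c / G.adjMatrix a b);
      -1, -(G.adjMatrix c a / G.adjMatrix a b); 0, 1]
  have hq (d : Fin 2 → ℝ) : ∑ i, ∑ j, g d i * G.adjMatrix (![a, b, c] i) (![a, b, c] j) * g d j =
      -2 * (G.adjMatrix a b * d 0 ^ 2 +
        G.adjMatrix b c * G.adjMatrix c a / G.adjMatrix a b * d 1 ^ 2) := by
    have := triangle_form pab.ne' (G.adjMatrix b c) (G.adjMatrix c a) (d 0) (d 1)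
    simp [g, Fin.sum_univ_three, mulVec, dotProduct, Fin.sum_univ_two, G.adjMatrix_eq_zero,
      G.adjMatrix_comm b a, G.adjMatrix_comm c b, G.adjMatrix_comm a c]
    linear_combination 2 * this
  refine G.le_negIndex_of_spread ![a, b, c] g (fun d => ?_) fun d hd => ?_
  · rw [hq]
    have : 0 ≤ G.adjMatrix a b * d 0 ^ 2 +
        G.adjMatrix b c * G.adjMatrix c a / G.adjMatrix a b * d 1 ^ 2 := by positivity
    linarith
  -- The form is negative definite here, so pairing `g d` with itself already forces `d = 0`.
  · have h0 := (hq d).symm.trans (hd (g d))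
    have h1 : 0 ≤ G.adjMatrix a b * d 0 ^ 2 := by positivity
    have h2 : 0 ≤ G.adjMatrix b c * G.adjMatrix c a / G.adjMatrix a b * d 1 ^ 2 := by positivity
    have h3 : G.adjMatrix a b * d 0 ^ 2 = 0 := by linarith
    have h4 : G.adjMatrix b c * G.adjMatrix c a / G.adjMatrix a b * d 1 ^ 2 = 0 := by linarith
    ext i
    fin_cases i
    · simpa [pab.ne'] using h3
    · simpa [pab.ne', pbc.ne', pca.ne'] using h4

/-- A triangle `a b c` and an edge `d e` such that `e` is adjacent to no vertex of the triangle. -/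
theorem three_le_negIndex_of_triangle_edge {a b c d e : V} (hab : G.graph.Adj a b)
    (hbc : G.graph.Adj b c) (hca : G.graph.Adj c a) (hde : G.graph.Adj d e)
    (hea : ¬ G.graph.Adj e a) (heb : ¬ G.graph.Adj e b) (hec : ¬ G.graph.Adj e c) :
    3 ≤ G.negIndex := by
  have pab := G.adjMatrix_pos hab
  have pbc := G.adjMatrix_pos hbc
  have pca := G.adjMatrix_pos hca
  have pde := G.adjMatrix_pos hde
  -- The third direction is the unit vector at `e`, isotropic and orthogonal to the triangle. The
  -- form is only semidefinite on this space.
  let g : (Fin 3 → ℝ) →ₗ[ℝ] (Fin 5 → ℝ) :=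
    Matrix.mulVecLin !![1, -(G.adjMatrix b c / G.adjMatrix a b), 0;
      -1, -(G.adjMatrix c a / G.adjMatrix a b), 0; 0, 1, 0; 0, 0, 0; 0, 0, 1]
  have hq (x : Fin 3 → ℝ) :
      ∑ i, ∑ j, g x i * G.adjMatrix (![a, b, c, d, e] i) (![a, b, c, d, e] j) * g x j =
      -2 * (G.adjMatrix a b * x 0 ^ 2 +
        G.adjMatrix b c * G.adjMatrix c a / G.adjMatrix a b * x 1 ^ 2) := by
    have := triangle_form pab.ne' (G.adjMatrix b c) (G.adjMatrix c a) (x 0) (x 1)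
    simp [g, Fin.sum_univ_five, mulVec, dotProduct, Fin.sum_univ_three, G.adjMatrix_eq_zero, hea,
      heb, hec, G.adjMatrix_comm _ e, G.adjMatrix_comm b a, G.adjMatrix_comm c b,
      G.adjMatrix_comm a c]
    linear_combination 2 * this
  refine G.le_negIndex_of_spread ![a, b, c, d, e] g (fun x => ?_) fun x hx => ?_
  · rw [hq]
    have : 0 ≤ G.adjMatrix a b * x 0 ^ 2 +
        G.adjMatrix b c * G.adjMatrix c a / G.adjMatrix a b * x 1 ^ 2 := by positivity
    linarith
  · have h0 := (hq x).symm.trans (hx (g x))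
    have h1 : 0 ≤ G.adjMatrix a b * x 0 ^ 2 := by positivity
    have h2 : 0 ≤ G.adjMatrix b c * G.adjMatrix c a / G.adjMatrix a b * x 1 ^ 2 := by positivity
    have h3 : G.adjMatrix a b * x 0 ^ 2 = 0 := by linarith
    have h4 : G.adjMatrix b c * G.adjMatrix c a / G.adjMatrix a b * x 1 ^ 2 = 0 := by linarith
    have x0 : x 0 = 0 := by simpa [pab.ne'] using h3
    have x1 : x 1 = 0 := by simpa [pab.ne', pbc.ne', pca.ne'] using h4
    -- Pairing with the vertex `d` shows that the isotropic direction is not in the kernel.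
    have h5 := hx ![0, 0, 0, 1, 0]
    have x2 : x 2 = 0 := by
      simpa [g, Fin.sum_univ_five, mulVec, dotProduct, Fin.sum_univ_three, x0, x1, pde.ne'] using h5
    ext i
    fin_cases i <;> simp [x0, x1, x2]

/-- Two triangles `v a b` and `v c d` that have no edges between them. -/
theorem three_le_negIndex_of_bowtie {v a b c d : V} (hva : G.graph.Adj v a)
    (hvb : G.graph.Adj v b) (hvc : G.graph.Adj v c) (hvd : G.graph.Adj v d)
    (hab : G.graph.Adj a b) (hcd : G.graph.Adj c d) (hac : ¬ G.graph.Adj a c)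
    (had : ¬ G.graph.Adj a d) (hbc : ¬ G.graph.Adj b c) (hbd : ¬ G.graph.Adj b d) :
    3 ≤ G.negIndex := by
  have pva := G.adjMatrix_pos hva
  have pvb := G.adjMatrix_pos hvb
  have pvc := G.adjMatrix_pos hvc
  have pvd := G.adjMatrix_pos hvd
  have pab := G.adjMatrix_pos hab
  have pcd := G.adjMatrix_pos hcd
  -- Negative directions of `ab` and `cd`, and the vector at `v` corrected to be orthogonal to both
  -- edges.
  let g : (Fin 3 → ℝ) →ₗ[ℝ] (Fin 5 → ℝ) :=
    Matrix.mulVecLin !![0, 1, 0; 1, -(G.adjMatrix v b / G.adjMatrix a b), 0;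
      -1, -(G.adjMatrix v a / G.adjMatrix a b), 0; 0, -(G.adjMatrix v d / G.adjMatrix c d), 1;
      0, -(G.adjMatrix v c / G.adjMatrix c d), -1]
  have hq (x : Fin 3 → ℝ) :
      ∑ i, ∑ j, g x i * G.adjMatrix (![v, a, b, c, d] i) (![v, a, b, c, d] j) * g x j =
      -2 * (G.adjMatrix a b * x 0 ^ 2 + G.adjMatrix v b * G.adjMatrix v a / G.adjMatrix a b * x 1 ^ 2
        + G.adjMatrix c d * x 2 ^ 2
        + G.adjMatrix v d * G.adjMatrix v c / G.adjMatrix c d * x 1 ^ 2) := by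
    have t1 := triangle_form pab.ne' (G.adjMatrix v b) (G.adjMatrix v a) (x 0) (x 1)
    have t2 := triangle_form pcd.ne' (G.adjMatrix v d) (G.adjMatrix v c) (x 2) (x 1)
    simp [g, Fin.sum_univ_five, mulVec, dotProduct, Fin.sum_univ_three, G.adjMatrix_eq_zero, hac,
      had, hbc, hbd, G.adjMatrix_comm c a, G.adjMatrix_comm c b, G.adjMatrix_comm d a,
      G.adjMatrix_comm d b, G.adjMatrix_comm b a, G.adjMatrix_comm d c, G.adjMatrix_comm _ v]
    linear_combination 2 * t1 + 2 * t2
  have hnn (x : Fin 3 → ℝ) : 0 ≤ G.adjMatrix a b * x 0 ^ 2 ∧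
      0 ≤ G.adjMatrix v b * G.adjMatrix v a / G.adjMatrix a b * x 1 ^ 2 ∧
      0 ≤ G.adjMatrix c d * x 2 ^ 2 ∧
      0 ≤ G.adjMatrix v d * G.adjMatrix v c / G.adjMatrix c d * x 1 ^ 2 := by
    refine ⟨?_, ?_, ?_, ?_⟩ <;> positivity
  refine G.le_negIndex_of_spread ![v, a, b, c, d] g (fun x => ?_) fun x hx => ?_
  · rw [hq]
    linarith [(hnn x).1, (hnn x).2.1, (hnn x).2.2.1, (hnn x).2.2.2]
  · have h0 := (hq x).symm.trans (hx (g x))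
    obtain ⟨h1, h2, h3, h4⟩ := hnn x
    have e1 : G.adjMatrix a b * x 0 ^ 2 = 0 := by linarith
    have e2 : G.adjMatrix v b * G.adjMatrix v a / G.adjMatrix a b * x 1 ^ 2 = 0 := by linarith
    have e3 : G.adjMatrix c d * x 2 ^ 2 = 0 := by linarith
    ext i
    fin_cases i
    · simpa [pab.ne'] using e1
    · simpa [pab.ne', pvb.ne', pva.ne'] using e2
    · simpa [pcd.ne'] using e3

end Obstructions

/-! ### The index of each θ-graph -/

section Theta

/-- The first endpoints of the edges of `θ(p, l, q)`. -/
def thetaSrc (p l q : ℕ) :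
    Fin (p + 1) ⊕ Fin (l + 1) ⊕ Fin (q + 1) → Bool ⊕ Fin p ⊕ Fin l ⊕ Fin q :=
  Sum.elim (fun k => pathVertex (.inl false) (.inl true) (fun i => .inr (.inl i)) k)
    (Sum.elim (fun k => pathVertex (.inl false) (.inl true) (fun i => .inr (.inr (.inl i))) k)
      (fun k => pathVertex (.inl false) (.inl true) (fun i => .inr (.inr (.inr i))) k))

/-- The second endpoints of the edges of `θ(p, l, q)`. -/
def thetaTgt (p l q : ℕ) :
    Fin (p + 1) ⊕ Fin (l + 1) ⊕ Fin (q + 1) → Bool ⊕ Fin p ⊕ Fin l ⊕ Fin q :=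
  Sum.elim (fun k => pathVertex (.inl false) (.inl true) (fun i => .inr (.inl i)) (k + 1))
    (Sum.elim (fun k => pathVertex (.inl false) (.inl true) (fun i => .inr (.inr (.inl i))) (k + 1))
      (fun k => pathVertex (.inl false) (.inl true) (fun i => .inr (.inr (.inr i))) (k + 1)))

theorem theta_eq_ofEdges (p l q : ℕ) (a : Fin (p + 1) → PosReal) (b : Fin (l + 1) → PosReal)
    (c : Fin (q + 1) → PosReal) :
    theta p l q a b c =
      ofEdges (fun k => s(thetaSrc p l q k, thetaTgt p l q k)) (Sum.elim a (Sum.elim b c)) := by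
  unfold theta
  dsimp only
  congr 1
  funext k
  rcases k with k | k | k <;> rfl

theorem form_theta {p l q : ℕ} (h : ∀ k, thetaSrc p l q k ≠ thetaTgt p l q k)
    (a : Fin (p + 1) → PosReal) (b : Fin (l + 1) → PosReal) (c : Fin (q + 1) → PosReal)
    (x y : Bool ⊕ Fin p ⊕ Fin l ⊕ Fin q → ℝ) :
    (theta p l q a b c).form x y =
      ∑ k, ((Sum.elim a (Sum.elim b c) k : PosReal) : ℝ) *
        (x (thetaSrc p l q k) * y (thetaTgt p l q k) +
          x (thetaTgt p l q k) * y (thetaSrc p l q k)) := by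
  rw [theta_eq_ofEdges, form_ofEdges _ _ h]

theorem theta_adj {p l q : ℕ} (a : Fin (p + 1) → PosReal) (b : Fin (l + 1) → PosReal)
    (c : Fin (q + 1) → PosReal) (x y : Bool ⊕ Fin p ⊕ Fin l ⊕ Fin q) :
    (theta p l q a b c).graph.Adj x y ↔
      (∃ k, s(thetaSrc p l q k, thetaTgt p l q k) = s(x, y)) ∧ x ≠ y := by
  rw [theta_eq_ofEdges]
  rfl

theorem form_theta_one_one_one (a₁ a₂ b₁ b₂ c₁ c₂ : PosReal)
    (x y : Bool ⊕ Fin 1 ⊕ Fin 1 ⊕ Fin 1 → ℝ) :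
    (theta 1 1 1 ![a₁, a₂] ![b₁, b₂] ![c₁, c₂]).form x y =
      a₁ * (x (.inl false) * y (.inr (.inl 0)) + x (.inr (.inl 0)) * y (.inl false)) +
      a₂ * (x (.inr (.inl 0)) * y (.inl true) + x (.inl true) * y (.inr (.inl 0))) +
      b₁ * (x (.inl false) * y (.inr (.inr (.inl 0))) +
        x (.inr (.inr (.inl 0))) * y (.inl false)) +
      b₂ * (x (.inr (.inr (.inl 0))) * y (.inl true) +
        x (.inl true) * y (.inr (.inr (.inl 0)))) +
      c₁ * (x (.inl false) * y (.inr (.inr (.inr 0))) +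
        x (.inr (.inr (.inr 0))) * y (.inl false)) +
      c₂ * (x (.inr (.inr (.inr 0))) * y (.inl true) +
        x (.inl true) * y (.inr (.inr (.inr 0)))) := by
  rw [form_theta (by decide)]
  simp [Fintype.sum_sum_type, Fin.sum_univ_succ, thetaSrc, thetaTgt, pathVertex]
  ring

/-- The graph is bipartite with parts of sizes 2 and 3, and the index is the rank of the biadjacency
matrix with rows `(a₁, b₁, c₁)` and `(a₂, b₂, c₂)`. -/
theorem negIndex_theta_one_one_one (a₁ a₂ b₁ b₂ c₁ c₂ : PosReal) :
    (theta 1 1 1 ![a₁, a₂] ![b₁, b₂] ![c₁, c₂]).negIndex = 2 ↔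
      ((a₂ : ℝ) * b₁ ≠ a₁ * b₂ ∨ (a₂ : ℝ) * c₁ ≠ a₁ * c₂) := by
  have hform := form_theta_one_one_one a₁ a₂ b₁ b₂ c₁ c₂
  set H := theta 1 1 1 ![a₁, a₂] ![b₁, b₂] ![c₁, c₂]
  have pa₁ := a₁.2
  have pa₂ := a₂.2
  have hle : H.negIndex ≤ 2 := by
    refine H.negIndex_le_of_form_nonneg
      (LinearMap.pi ![LinearMap.proj (.inl false), LinearMap.proj (.inl true)]) fun x hx => ?_
    have h0 := congrFun hx 0
    have h1 := congrFun hx 1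
    simp at h0 h1
    simp [hform, h0, h1]
  constructor
  · intro h
    by_contra! hc
    obtain ⟨hb, hc⟩ := hc
    have : H.negIndex ≤ 1 := by
      -- For proportional rows the form is, up to a positive factor, the product of this functional
      -- and `a₁ u + a₂ v`.
      refine H.negIndex_le_of_form_nonneg
        (LinearMap.pi ![(a₁ : ℝ) • LinearMap.proj (.inr (.inl 0)) +
          (b₁ : ℝ) • LinearMap.proj (.inr (.inr (.inl 0))) +
          (c₁ : ℝ) • LinearMap.proj (.inr (.inr (.inr 0)))]) fun x hx => ?_
      have h0 := congrFun hx 0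
      simp at h0
      have key : a₁ * H.form x x = 0 := by
        rw [hform]
        linear_combination (2 * (a₁ * x (.inl false) + a₂ * x (.inl true))) * h0 -
          2 * x (.inl true) * x (.inr (.inr (.inl 0))) * hb -
          2 * x (.inl true) * x (.inr (.inr (.inr 0))) * hc
      exact nonneg_of_mul_nonneg_right key.ge pa₁
    omega
  · intro h
    refine le_antisymm hle (H.le_negIndex_of_form_nonpos
      (spread ![.inl false, .inl true]) (fun c => ?_) fun c hc => ?_)
    · simp [hform, spread]
    · have h0 := hc (Pi.single (.inr (.inl 0)) 1)
      have h1 := hc (Pi.single (.inr (.inr (.inl 0))) 1)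
      have h2 := hc (Pi.single (.inr (.inr (.inr 0))) 1)
      simp [hform, spread, Fin.sum_univ_two] at h0 h1 h2
      have c0 : c 0 = 0 := by
        rcases h with h | h
        · exact mul_left_cancel₀ (sub_ne_zero.2 h) (by linear_combination a₂ * h1 - b₂ * h0)
        · exact mul_left_cancel₀ (sub_ne_zero.2 h) (by linear_combination a₂ * h2 - c₂ * h0)
      have c1 : c 1 = 0 := by simpa [c0, pa₂.ne'] using h0
      ext i
      fin_cases i <;> simp [c0, c1]

theorem form_theta_one_zero_one (a₁ a₂ b₁ c₁ c₂ : PosReal)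
    (x y : Bool ⊕ Fin 1 ⊕ Fin 0 ⊕ Fin 1 → ℝ) :
    (theta 1 0 1 ![a₁, a₂] ![b₁] ![c₁, c₂]).form x y =
      a₁ * (x (.inl false) * y (.inr (.inl 0)) + x (.inr (.inl 0)) * y (.inl false)) +
      a₂ * (x (.inr (.inl 0)) * y (.inl true) + x (.inl true) * y (.inr (.inl 0))) +
      b₁ * (x (.inl false) * y (.inl true) + x (.inl true) * y (.inl false)) +
      c₁ * (x (.inl false) * y (.inr (.inr (.inr 0))) + x (.inr (.inr (.inr 0))) * y (.inl false)) +
      c₂ * (x (.inr (.inr (.inr 0))) * y (.inl true) + x (.inl true) * y (.inr (.inr (.inr 0)))) := by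
  rw [form_theta (by decide)]
  simp [Fintype.sum_sum_type, Fin.sum_univ_succ, thetaSrc, thetaTgt, pathVertex]
  ring

theorem negIndex_theta_one_zero_one (a₁ a₂ b₁ c₁ c₂ : PosReal) :
    (theta 1 0 1 ![a₁, a₂] ![b₁] ![c₁, c₂]).negIndex = 2 := by
  have hform := form_theta_one_zero_one a₁ a₂ b₁ c₁ c₂
  have hadj := theta_adj ![a₁, a₂] ![b₁] ![c₁, c₂]
  set H := theta 1 0 1 ![a₁, a₂] ![b₁] ![c₁, c₂]
  apply le_antisymm
  · refine H.negIndex_le_of_form_nonneg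
      (LinearMap.pi ![LinearMap.proj (.inl false), LinearMap.proj (.inl true)]) fun x hx => ?_
    have h0 := congrFun hx 0
    have h1 := congrFun hx 1
    simp at h0 h1
    simp [hform, h0, h1]
  · exact H.two_le_negIndex_of_triangle (a := .inl false) (b := .inl true) (c := .inr (.inl 0))
      ((hadj _ _).2 (by decide)) ((hadj _ _).2 (by decide)) ((hadj _ _).2 (by decide))

theorem form_theta_one_zero_two (a₁ a₂ b₁ c₁ c₂ c₃ : PosReal)
    (x y : Bool ⊕ Fin 1 ⊕ Fin 0 ⊕ Fin 2 → ℝ) :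
    (theta 1 0 2 ![a₁, a₂] ![b₁] ![c₁, c₂, c₃]).form x y =
      a₁ * (x (.inl false) * y (.inr (.inl 0)) + x (.inr (.inl 0)) * y (.inl false)) +
      a₂ * (x (.inr (.inl 0)) * y (.inl true) + x (.inl true) * y (.inr (.inl 0))) +
      b₁ * (x (.inl false) * y (.inl true) + x (.inl true) * y (.inl false)) +
      c₁ * (x (.inl false) * y (.inr (.inr (.inr 0))) + x (.inr (.inr (.inr 0))) * y (.inl false)) +
      c₂ * (x (.inr (.inr (.inr 0))) * y (.inr (.inr (.inr 1))) + x (.inr (.inr (.inr 1))) * y (.inr (.inr (.inr 0)))) +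
      c₃ * (x (.inr (.inr (.inr 1))) * y (.inl true) + x (.inl true) * y (.inr (.inr (.inr 1)))) := by
  rw [form_theta (by decide)]
  simp [Fintype.sum_sum_type, Fin.sum_univ_succ, thetaSrc, thetaTgt, pathVertex]
  ring

/-- Splitting off the edge of weight `c₂` leaves a triangle in which `uv` has weight `b₁ - c₁c₃/c₂`.
It has two negative eigenvalues if this is positive, and one otherwise. -/
theorem negIndex_theta_one_zero_two (a₁ a₂ b₁ c₁ c₂ c₃ : PosReal) :
    (theta 1 0 2 ![a₁, a₂] ![b₁] ![c₁, c₂, c₃]).negIndex = 2 ↔ (b₁ : ℝ) * c₂ ≤ c₁ * c₃ := by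
  have hform := form_theta_one_zero_two a₁ a₂ b₁ c₁ c₂ c₃
  have hadj := theta_adj ![a₁, a₂] ![b₁] ![c₁, c₂, c₃]
  set H := theta 1 0 2 ![a₁, a₂] ![b₁] ![c₁, c₂, c₃]
  have pa₁ := a₁.2
  have pa₂ := a₂.2
  have pc₂ := c₂.2
  constructor
  · intro h
    by_contra! hlt
    have hD := sub_pos.2 hlt
    set D := (b₁ : ℝ) * c₂ - c₁ * c₃ with hDdef
    -- `d 0` is the negative direction of the split edge. `d 1` and `d 2` are the triangle
    -- directions of `triangle_form` for the corrected weight `D / c₂`, made orthogonal to that edge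
    -- and cleared of denominators.
    let g : (Fin 3 → ℝ) →ₗ[ℝ] (Bool ⊕ Fin 1 ⊕ Fin 0 ⊕ Fin 2 → ℝ) :=
      { toFun := fun d => Sum.elim
          (fun i => if i then c₂ * (-d 1 - a₁ * c₂ * d 2) else c₂ * (d 1 - a₂ * c₂ * d 2))
          (Sum.elim ![c₂ * D * d 2] (Sum.elim ![]
            ![d 0 + c₃ * (d 1 + a₁ * c₂ * d 2), -d 0 - c₁ * (d 1 - a₂ * c₂ * d 2)]))
        map_add' := by
          intro d e
          ext i
          rcases i with (_ | _) | i | i | i <;> (try fin_cases i) <;> simp <;> ring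
        map_smul' := by
          intro r d
          ext i
          rcases i with (_ | _) | i | i | i <;> (try fin_cases i) <;> simp <;> ring }
    have hq (d : Fin 3 → ℝ) : H.form (g d) (g d) =
        -2 * c₂ * (d 0 ^ 2 + D * d 1 ^ 2 + D * (a₁ * a₂) * (c₂ * d 2) ^ 2) := by
      simp only [hform]
      simp [g]
      rw [hDdef]
      ring
    have : 3 ≤ H.negIndex := H.le_negIndex_of_form_neg g fun d hd => by
      rw [hq] at hd
      have h0 : 0 ≤ d 0 ^ 2 := by positivity
      have h1 : 0 ≤ D * d 1 ^ 2 := by positivity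
      have h2 : 0 ≤ D * (a₁ * a₂) * (c₂ * d 2) ^ 2 := by positivity
      have hs : d 0 ^ 2 + D * d 1 ^ 2 + D * (a₁ * a₂) * (c₂ * d 2) ^ 2 ≤ 0 := by
        nlinarith
      have e0 : d 0 = 0 := by simpa using (by linarith : d 0 ^ 2 = 0)
      have e1 : d 1 = 0 := by simpa [hD.ne'] using (by linarith : D * d 1 ^ 2 = 0)
      have e2 : d 2 = 0 := by
        simpa [hD.ne', pa₁.ne', pa₂.ne', pc₂.ne'] using
          (by linarith : D * (a₁ * a₂) * (c₂ * d 2) ^ 2 = 0)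
      ext i
      fin_cases i <;> simp [e0, e1, e2]
    omega
  · intro h
    apply le_antisymm
    -- The functionals are the rows of `A` at the second inner vertex of the long path and at the
    -- inner vertex of the short one.
    · refine H.negIndex_le_of_form_nonneg (LinearMap.pi
        ![(c₂ : ℝ) • LinearMap.proj (.inr (.inr (.inr 0))) + (c₃ : ℝ) • LinearMap.proj (.inl true),
          (a₁ : ℝ) • LinearMap.proj (.inl false) + (a₂ : ℝ) • LinearMap.proj (.inl true)])
        fun x hx => ?_
      have h0 := congrFun hx 0
      have h1 := congrFun hx 1
      simp at h0 h1
      have key : a₁ * c₂ * H.form x x = 2 * a₂ * (c₁ * c₃ - b₁ * c₂) * x (.inl true) ^ 2 := by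
        rw [hform]
        linear_combination 2 * (a₁ * c₂ * x (.inr (.inl 0)) + (b₁ * c₂ - c₁ * c₃) * x (.inl true)) * h1 + 2 * (a₁ * c₂ * x (.inr (.inr (.inr 1))) + a₁ * c₁ * x (.inl false)) * h0
      have : 0 ≤ a₁ * c₂ * H.form x x := by
        rw [key]
        have := sub_nonneg.2 h
        positivity
      exact nonneg_of_mul_nonneg_right this (by positivity)
    · exact H.two_le_negIndex_of_triangular (x₁ := .inr (.inl 0)) (x₂ := .inr (.inr (.inr 0)))
        (y₁ := .inl true) (y₂ := .inr (.inr (.inr 1))) (mt (hadj _ _).1 (by decide))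
        ((hadj _ _).2 (by decide)) ((hadj _ _).2 (by decide)) (mt (hadj _ _).1 (by decide))

theorem form_theta_two_zero_two (a₁ a₂ a₃ b₁ c₁ c₂ c₃ : PosReal)
    (x y : Bool ⊕ Fin 2 ⊕ Fin 0 ⊕ Fin 2 → ℝ) :
    (theta 2 0 2 ![a₁, a₂, a₃] ![b₁] ![c₁, c₂, c₃]).form x y =
      a₁ * (x (.inl false) * y (.inr (.inl 0)) + x (.inr (.inl 0)) * y (.inl false)) +
      a₂ * (x (.inr (.inl 0)) * y (.inr (.inl 1)) + x (.inr (.inl 1)) * y (.inr (.inl 0))) +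
      a₃ * (x (.inr (.inl 1)) * y (.inl true) + x (.inl true) * y (.inr (.inl 1))) +
      b₁ * (x (.inl false) * y (.inl true) + x (.inl true) * y (.inl false)) +
      c₁ * (x (.inl false) * y (.inr (.inr (.inr 0))) + x (.inr (.inr (.inr 0))) * y (.inl false)) +
      c₂ * (x (.inr (.inr (.inr 0))) * y (.inr (.inr (.inr 1))) + x (.inr (.inr (.inr 1))) * y (.inr (.inr (.inr 0)))) +
      c₃ * (x (.inr (.inr (.inr 1))) * y (.inl true) + x (.inl true) * y (.inr (.inr (.inr 1)))) := by
  rw [form_theta (by decide)]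
  simp [Fintype.sum_sum_type, Fin.sum_univ_succ, thetaSrc, thetaTgt, pathVertex]
  ring

/-- Splitting off the middle edges of both long paths leaves the edge `uv` with weight `b₁ - a₁a₃/a₂
- c₁c₃/c₂`, which contributes a third negative eigenvalue unless it is zero. -/
theorem negIndex_theta_two_zero_two (a₁ a₂ a₃ b₁ c₁ c₂ c₃ : PosReal) :
    (theta 2 0 2 ![a₁, a₂, a₃] ![b₁] ![c₁, c₂, c₃]).negIndex = 2 ↔
      (a₂ : ℝ) * b₁ * c₂ - a₁ * a₃ * c₂ - a₂ * c₁ * c₃ = 0 := by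
  have hform := form_theta_two_zero_two a₁ a₂ a₃ b₁ c₁ c₂ c₃
  have hadj := theta_adj ![a₁, a₂, a₃] ![b₁] ![c₁, c₂, c₃]
  set H := theta 2 0 2 ![a₁, a₂, a₃] ![b₁] ![c₁, c₂, c₃]
  have pa₂ := a₂.2
  have pc₂ := c₂.2
  constructor
  · intro h
    by_contra hD
    set D := (a₂ : ℝ) * b₁ * c₂ - a₁ * a₃ * c₂ - a₂ * c₁ * c₃ with hDdef
    -- The factor `-D` at `v` makes the contribution of `uv` a negative multiple of `D²`, whichever
    -- sign `D` has.
    let g : (Fin 3 → ℝ) →ₗ[ℝ] (Bool ⊕ Fin 2 ⊕ Fin 0 ⊕ Fin 2 → ℝ) :=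
      { toFun := fun d => Sum.elim
          (fun i => if i then -D * a₂ * c₂ * d 2 else a₂ * c₂ * d 2)
          (Sum.elim ![d 0 + a₃ * D * c₂ * d 2, -d 0 - a₁ * c₂ * d 2] (Sum.elim ![]
            ![d 1 + c₃ * D * a₂ * d 2, -d 1 - c₁ * a₂ * d 2]))
        map_add' := by
          intro d e
          ext i
          rcases i with (_ | _) | i | i | i <;> (try fin_cases i) <;> simp <;> ring
        map_smul' := by
          intro r d
          ext i
          rcases i with (_ | _) | i | i | i <;> (try fin_cases i) <;> simp <;> ring }
    have hq (d : Fin 3 → ℝ) : H.form (g d) (g d) =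
        -2 * (a₂ * d 0 ^ 2 + c₂ * d 1 ^ 2 + a₂ * c₂ * (D * d 2) ^ 2) := by
      simp only [hform]
      simp [g]
      rw [hDdef]
      ring
    have : 3 ≤ H.negIndex := H.le_negIndex_of_form_neg g fun d hd => by
      rw [hq] at hd
      have h0 : 0 ≤ a₂ * d 0 ^ 2 := by positivity
      have h1 : 0 ≤ c₂ * d 1 ^ 2 := by positivity
      have h2 : 0 ≤ a₂ * c₂ * (D * d 2) ^ 2 := by positivity
      have e0 : d 0 = 0 := by simpa [pa₂.ne'] using (by linarith : a₂ * d 0 ^ 2 = 0)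
      have e1 : d 1 = 0 := by simpa [pc₂.ne'] using (by linarith : c₂ * d 1 ^ 2 = 0)
      have e2 : d 2 = 0 := by
        simpa [hD, pa₂.ne', pc₂.ne'] using (by linarith : a₂ * c₂ * (D * d 2) ^ 2 = 0)
      ext i
      fin_cases i <;> simp [e0, e1, e2]
    omega
  · intro h
    apply le_antisymm
    · refine H.negIndex_le_of_form_nonneg (LinearMap.pi
        ![(a₂ : ℝ) • LinearMap.proj (.inr (.inl 0)) + (a₃ : ℝ) • LinearMap.proj (.inl true),
          (c₂ : ℝ) • LinearMap.proj (.inr (.inr (.inr 0))) + (c₃ : ℝ) • LinearMap.proj (.inl true)])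
        fun x hx => ?_
      have h0 := congrFun hx 0
      have h1 := congrFun hx 1
      simp at h0 h1
      have key : a₂ * c₂ * H.form x x = 0 := by
        rw [hform]
        linear_combination 2 * (a₂ * c₂ * x (.inr (.inl 1)) + a₁ * c₂ * x (.inl false)) * h0 + 2 * (a₂ * c₂ * x (.inr (.inr (.inr 1))) + c₁ * a₂ * x (.inl false)) * h1 + 2 * x (.inl false) * x (.inl true) * h
      exact nonneg_of_mul_nonneg_right key.ge (by positivity)
    · exact H.two_le_negIndex_of_triangular (x₁ := .inr (.inl 0)) (x₂ := .inr (.inr (.inr 0)))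
        (y₁ := .inr (.inl 1)) (y₂ := .inr (.inr (.inr 1))) (mt (hadj _ _).1 (by decide))
        ((hadj _ _).2 (by decide)) ((hadj _ _).2 (by decide)) (mt (hadj _ _).1 (by decide))

theorem form_theta_one_one_two (a₁ a₂ b₁ b₂ c₁ c₂ c₃ : PosReal)
    (x y : Bool ⊕ Fin 1 ⊕ Fin 1 ⊕ Fin 2 → ℝ) :
    (theta 1 1 2 ![a₁, a₂] ![b₁, b₂] ![c₁, c₂, c₃]).form x y =
      a₁ * (x (.inl false) * y (.inr (.inl 0)) + x (.inr (.inl 0)) * y (.inl false)) +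
      a₂ * (x (.inr (.inl 0)) * y (.inl true) + x (.inl true) * y (.inr (.inl 0))) +
      b₁ * (x (.inl false) * y (.inr (.inr (.inl 0))) + x (.inr (.inr (.inl 0))) * y (.inl false)) +
      b₂ * (x (.inr (.inr (.inl 0))) * y (.inl true) + x (.inl true) * y (.inr (.inr (.inl 0)))) +
      c₁ * (x (.inl false) * y (.inr (.inr (.inr 0))) + x (.inr (.inr (.inr 0))) * y (.inl false)) +
      c₂ * (x (.inr (.inr (.inr 0))) * y (.inr (.inr (.inr 1))) + x (.inr (.inr (.inr 1))) * y (.inr (.inr (.inr 0)))) +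
      c₃ * (x (.inr (.inr (.inr 1))) * y (.inl true) + x (.inl true) * y (.inr (.inr (.inr 1)))) := by
  rw [form_theta (by decide)]
  simp [Fintype.sum_sum_type, Fin.sum_univ_succ, thetaSrc, thetaTgt, pathVertex]
  ring

/-- Without proportionality, three pairwise nonadjacent vertices have independent columns. With it,
the rows at the two single inner vertices vanish together, and the computation is that of θ(1,0,2)
with `b₁ = 0`. -/
theorem negIndex_theta_one_one_two (a₁ a₂ b₁ b₂ c₁ c₂ c₃ : PosReal) :
    (theta 1 1 2 ![a₁, a₂] ![b₁, b₂] ![c₁, c₂, c₃]).negIndex = 2 ↔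
      (a₁ : ℝ) * b₂ = a₂ * b₁ := by
  have hform := form_theta_one_one_two a₁ a₂ b₁ b₂ c₁ c₂ c₃
  have hadj := theta_adj ![a₁, a₂] ![b₁, b₂] ![c₁, c₂, c₃]
  set H := theta 1 1 2 ![a₁, a₂] ![b₁, b₂] ![c₁, c₂, c₃]
  have pa₁ := a₁.2
  have pa₂ := a₂.2
  have pb₂ := b₂.2
  have pc₁ := c₁.2
  have pc₂ := c₂.2
  have pc₃ := c₃.2
  constructor
  · intro h
    by_contra hD
    have : 3 ≤ H.negIndex := by
      refine H.le_negIndex_of_form_nonpos (spread ![.inr (.inl 0), .inr (.inr (.inl 0)), .inr (.inr (.inr 0))])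
        (fun d => ?_) fun d hd => ?_
      · simp [hform, spread, Fin.sum_univ_three]
      · have h0 := hd (Pi.single (.inr (.inr (.inr 1))) 1)
        have h1 := hd (Pi.single (.inl false) 1)
        have h2 := hd (Pi.single (.inl true) 1)
        simp [hform, spread, Fin.sum_univ_three, pc₂.ne'] at h0 h1 h2
        simp [h0] at h1
        have d0 : d 0 = 0 :=
          mul_left_cancel₀ (sub_ne_zero.2 hD) (by linear_combination b₂ * h1 - b₁ * h2)
        have d1 : d 1 = 0 := by simpa [d0, pb₂.ne'] using h2
        ext i
        fin_cases i <;> simp [d0, d1, h0]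
    omega
  · intro h
    apply le_antisymm
    · refine H.negIndex_le_of_form_nonneg (LinearMap.pi
        ![(c₂ : ℝ) • LinearMap.proj (.inr (.inr (.inr 0))) + (c₃ : ℝ) • LinearMap.proj (.inl true),
          (a₁ : ℝ) • LinearMap.proj (.inl false) + (a₂ : ℝ) • LinearMap.proj (.inl true)])
        fun x hx => ?_
      have h0 := congrFun hx 0
      have h1 := congrFun hx 1
      simp at h0 h1
      have key : a₁ * c₂ * H.form x x = 2 * a₂ * (c₁ * c₃) * x (.inl true) ^ 2 := by
        rw [hform]
        linear_combination 2 * (a₁ * c₂ * x (.inr (.inl 0)) + c₂ * b₁ * x (.inr (.inr (.inl 0))) - c₁ * c₃ * x (.inl true)) * h1 + 2 * (a₁ * c₂ * x (.inr (.inr (.inr 1))) + a₁ * c₁ * x (.inl false)) * h0 + 2 * c₂ * x (.inr (.inr (.inl 0))) * x (.inl true) * h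
      have : 0 ≤ a₁ * c₂ * H.form x x := by
        rw [key]
        positivity
      exact nonneg_of_mul_nonneg_right this (by positivity)
    · exact H.two_le_negIndex_of_triangular (x₁ := .inr (.inl 0)) (x₂ := .inr (.inr (.inr 0)))
        (y₁ := .inl true) (y₂ := .inr (.inr (.inr 1))) (mt (hadj _ _).1 (by decide))
        ((hadj _ _).2 (by decide)) ((hadj _ _).2 (by decide)) (mt (hadj _ _).1 (by decide))

end Theta

/-! ### The index of ∞(4,1,4) -/

section Infty

/-- The first endpoints of the edges of `∞(p, l, q)`. -/
def inftySrc (p l q : ℕ) [NeZero l] :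
    Fin p ⊕ Fin q ⊕ Fin (l - 1) → Fin l ⊕ Fin (p - 1) ⊕ Fin (q - 1) :=
  Sum.elim (fun k => pathVertex (.inl (Fin.ofNat l 0)) (.inl (Fin.ofNat l 0))
      (fun i => .inr (.inl i)) k)
    (Sum.elim (fun k => pathVertex (.inl (Fin.ofNat l (l - 1))) (.inl (Fin.ofNat l (l - 1)))
      (fun i => .inr (.inr i)) k) (fun k => .inl (Fin.ofNat l k)))

/-- The second endpoints of the edges of `∞(p, l, q)`. -/
def inftyTgt (p l q : ℕ) [NeZero l] :
    Fin p ⊕ Fin q ⊕ Fin (l - 1) → Fin l ⊕ Fin (p - 1) ⊕ Fin (q - 1) :=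
  Sum.elim (fun k => pathVertex (.inl (Fin.ofNat l 0)) (.inl (Fin.ofNat l 0))
      (fun i => .inr (.inl i)) (k + 1))
    (Sum.elim (fun k => pathVertex (.inl (Fin.ofNat l (l - 1))) (.inl (Fin.ofNat l (l - 1)))
      (fun i => .inr (.inr i)) (k + 1)) (fun k => .inl (Fin.ofNat l (k + 1))))

theorem infty_eq_ofEdges (p l q : ℕ) [NeZero l] (a : Fin p → PosReal) (b : Fin q → PosReal)
    (c : Fin (l - 1) → PosReal) :
    infty p l q a b c =
      ofEdges (fun k => s(inftySrc p l q k, inftyTgt p l q k)) (Sum.elim a (Sum.elim b c)) := by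
  unfold infty
  dsimp only
  congr 1
  funext k
  rcases k with k | k | k <;> rfl

theorem infty_adj {p l q : ℕ} [NeZero l] (a : Fin p → PosReal) (b : Fin q → PosReal)
    (c : Fin (l - 1) → PosReal) (x y : Fin l ⊕ Fin (p - 1) ⊕ Fin (q - 1)) :
    (infty p l q a b c).graph.Adj x y ↔
      (∃ k, s(inftySrc p l q k, inftyTgt p l q k) = s(x, y)) ∧ x ≠ y := by
  rw [infty_eq_ofEdges]
  rfl

theorem form_infty_four_one_four (a₁ a₂ a₃ a₄ b₁ b₂ b₃ b₄ : PosReal)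
    (x y : Fin 1 ⊕ Fin (4 - 1) ⊕ Fin (4 - 1) → ℝ) :
    (infty 4 1 4 ![a₁, a₂, a₃, a₄] ![b₁, b₂, b₃, b₄] ![]).form x y =
      a₁ * (x (.inl 0) * y (.inr (.inl 0)) + x (.inr (.inl 0)) * y (.inl 0)) +
      a₂ * (x (.inr (.inl 0)) * y (.inr (.inl 1)) + x (.inr (.inl 1)) * y (.inr (.inl 0))) +
      a₃ * (x (.inr (.inl 1)) * y (.inr (.inl 2)) + x (.inr (.inl 2)) * y (.inr (.inl 1))) +
      a₄ * (x (.inr (.inl 2)) * y (.inl 0) + x (.inl 0) * y (.inr (.inl 2))) +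
      b₁ * (x (.inl 0) * y (.inr (.inr 0)) + x (.inr (.inr 0)) * y (.inl 0)) +
      b₂ * (x (.inr (.inr 0)) * y (.inr (.inr 1)) + x (.inr (.inr 1)) * y (.inr (.inr 0))) +
      b₃ * (x (.inr (.inr 1)) * y (.inr (.inr 2)) + x (.inr (.inr 2)) * y (.inr (.inr 1))) +
      b₄ * (x (.inr (.inr 2)) * y (.inl 0) + x (.inl 0) * y (.inr (.inr 2))) := by
  rw [infty_eq_ofEdges, form_ofEdges _ _ (by decide)]
  simp [Fintype.sum_sum_type, Fin.sum_univ_succ, inftySrc, inftyTgt, pathVertex]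
  ring

/-- The graph is bipartite, one part being the centre and the two vertices opposite to it. The rank
drops from 3 to 2 exactly when the centre's row is proportional, on each cycle, to that of the
opposite vertex. -/
theorem negIndex_infty_four_one_four (a₁ a₂ a₃ a₄ b₁ b₂ b₃ b₄ : PosReal) :
    (infty 4 1 4 ![a₁, a₂, a₃, a₄] ![b₁, b₂, b₃, b₄] ![]).negIndex = 2 ↔
      (a₁ : ℝ) * a₃ = a₂ * a₄ ∧ (b₁ : ℝ) * b₃ = b₂ * b₄ := by
  have hform := form_infty_four_one_four a₁ a₂ a₃ a₄ b₁ b₂ b₃ b₄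
  have hadj := infty_adj (l := 1) ![a₁, a₂, a₃, a₄] ![b₁, b₂, b₃, b₄] ![]
  set H := infty 4 1 4 ![a₁, a₂, a₃, a₄] ![b₁, b₂, b₃, b₄] ![]
  have pa₂ := a₂.2
  have pb₂ := b₂.2
  constructor
  · intro h
    by_contra hD
    have : 3 ≤ H.negIndex := by
      refine H.le_negIndex_of_form_nonpos (spread ![.inl 0, .inr (.inl 1), .inr (.inr 1)])
        (fun d => ?_) fun d hd => ?_
      · simp [hform, spread, Fin.sum_univ_three]
      · have h0 := hd (Pi.single (.inr (.inl 0)) 1)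
        have h1 := hd (Pi.single (.inr (.inl 2)) 1)
        have h2 := hd (Pi.single (.inr (.inr 0)) 1)
        have h3 := hd (Pi.single (.inr (.inr 2)) 1)
        simp [hform, spread, Fin.sum_univ_three] at h0 h1 h2 h3
        have d0 : d 0 = 0 := by
          rcases not_and_or.1 hD with hD | hD
          · exact mul_left_cancel₀ (sub_ne_zero.2 hD) (by linear_combination a₃ * h0 - a₂ * h1)
          · exact mul_left_cancel₀ (sub_ne_zero.2 hD) (by linear_combination b₃ * h2 - b₂ * h3)
        have d1 : d 1 = 0 := by simpa [d0, pa₂.ne'] using h0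
        have d2 : d 2 = 0 := by simpa [d0, pb₂.ne'] using h2
        ext i
        fin_cases i <;> simp [d0, d1, d2]
    omega
  · rintro ⟨ha, hb⟩
    apply le_antisymm
    · refine H.negIndex_le_of_form_nonneg (LinearMap.pi
        ![(a₂ : ℝ) • LinearMap.proj (.inr (.inl 0)) + (a₃ : ℝ) • LinearMap.proj (.inr (.inl 2)),
          (b₂ : ℝ) • LinearMap.proj (.inr (.inr 0)) + (b₃ : ℝ) • LinearMap.proj (.inr (.inr 2))])
        fun x hx => ?_
      have h0 := congrFun hx 0
      have h1 := congrFun hx 1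
      simp at h0 h1
      have key : a₂ * b₂ * H.form x x = 0 := by
        rw [hform]
        linear_combination 2 * b₂ * (a₁ * x (.inl 0) + a₂ * x (.inr (.inl 1))) * h0 + 2 * a₂ * (b₁ * x (.inl 0) + b₂ * x (.inr (.inr 1))) * h1 - 2 * b₂ * x (.inl 0) * x (.inr (.inl 2)) * ha - 2 * a₂ * x (.inl 0) * x (.inr (.inr 2)) * hb
      exact nonneg_of_mul_nonneg_right key.ge (by positivity)
    · exact H.two_le_negIndex_of_triangular (x₁ := .inr (.inl 1)) (x₂ := .inr (.inr 1))
        (y₁ := .inr (.inl 0)) (y₂ := .inr (.inr 0)) (mt (hadj _ _).1 (by decide))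
        ((hadj _ _).2 (by decide)) ((hadj _ _).2 (by decide)) (mt (hadj _ _).1 (by decide))

end Infty

/-! ### Recognizing a shape from its neighbourhoods -/

section Construction

variable {V W ι : Type*} [Fintype V] [Fintype W] [DecidableEq W] [Fintype ι]
  {G : WeightedGraph V}

omit [Fintype V] [Fintype W] [DecidableEq W] in
/-- A set of vertices closed under adjacency contains all vertices of a connected graph. -/
theorem surjective_of_closed [Nonempty W] (hG : G.graph.Connected) {f : W → V}
    (hf : ∀ x z, G.graph.Adj (f x) z → ∃ y, f y = z) : Function.Surjective f := by
  intro z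
  obtain ⟨p⟩ := hG.preconnected (f (Classical.arbitrary W)) z
  have key : ∀ (x y : V), G.graph.Walk x y → (∃ a, f a = x) → ∃ b, f b = y := by
    intro x y p
    induction p with
    | nil => exact id
    | cons h _ ih =>
      rintro ⟨a, rfl⟩
      exact ih (hf a _ h)
  exact key _ _ p ⟨_, rfl⟩

/-- A bicyclic graph is isomorphic to a given one with one more edge than vertices, if the latter
embeds onto a set of vertices that is closed under adjacency. -/
theorem isomorphic_ofEdges [Nonempty W] (hG : G.IsBicyclic) (s t : ι → W)
    (hst : Function.Injective fun k => s(s k, t k))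
    (hcard : Fintype.card ι = Fintype.card W + 1) {f : W → V} (hf : Function.Injective f)
    (hclosed : ∀ x z, G.graph.Adj (f x) z → ∃ y, f y = z)
    (hadj : ∀ k, G.graph.Adj (f (s k)) (f (t k))) (w : ι → PosReal)
    (hw : ∀ k, (w k : ℝ) = G.weight s(f (s k), f (t k))) :
    G.Isomorphic (ofEdges (fun k => s(s k, t k)) w) := by
  have hsurj := surjective_of_closed hG.1 hclosed
  let e : W ≃ V := Equiv.ofBijective f ⟨hf, hsurj⟩
  have hmap : Function.Injective fun k => (s(s k, t k)).map f :=
    (Sym2.map.injective hf).comp hst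
  -- The listed edges map injectively to edges of `G` and are as many as all its edges, so
  -- nonadjacency never has to be checked.
  have hedges : Set.range (fun k => (s(s k, t k)).map f) = G.graph.edgeSet := by
    apply Set.eq_of_subset_of_ncard_le
    · rintro _ ⟨k, rfl⟩
      exact hadj k
    · rw [hG.2, ← Set.image_univ, Set.ncard_image_of_injective _ hmap, Set.ncard_univ,
        Nat.card_eq_fintype_card, Nat.card_eq_fintype_card, hcard, Fintype.card_congr e]
    · exact Set.toFinite _
  have hiff (x y : W) : G.graph.Adj (e x) (e y) ↔
      (ofEdges (fun k => s(s k, t k)) w).graph.Adj x y := by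
    rw [← SimpleGraph.mem_edgeSet, ← hedges]
    simp only [ofEdges, SimpleGraph.fromEdgeSet_adj, Set.mem_range]
    constructor
    · rintro ⟨k, hk⟩
      have hk' : s(s k, t k) = s(x, y) := Sym2.map.injective hf hk
      refine ⟨⟨k, hk'⟩, ?_⟩
      rintro rfl
      have h1 := hadj k
      rw [Sym2.eq_iff] at hk'
      rcases hk' with ⟨h2, h3⟩ | ⟨h2, h3⟩ <;> simp [h2, h3] at h1
    · rintro ⟨⟨k, hk⟩, -⟩
      exact ⟨k, congrArg (Sym2.map f) hk⟩
  let φ : (ofEdges (fun k => s(s k, t k)) w).graph ≃g G.graph := ⟨e, fun {x y} => hiff x y⟩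
  refine ⟨φ.symm, fun x y hxy => ?_⟩
  obtain ⟨x, rfl⟩ := e.surjective x
  obtain ⟨y, rfl⟩ := e.surjective y
  have h1 : φ.symm (e x) = x := e.symm_apply_apply x
  have h2 : φ.symm (e y) = y := e.symm_apply_apply y
  rw [h1, h2]
  obtain ⟨⟨k, hk⟩, -⟩ := (hiff x y).1 hxy
  have hfil : Finset.univ.filter (fun j => s(s j, t j) = s(x, y)) = {k} := by
    ext j
    simp only [Finset.mem_filter, Finset.mem_univ, true_and, Finset.mem_singleton]
    exact ⟨fun h => hst (h.trans hk.symm), fun h => h ▸ hk⟩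
  simp only [ofEdges, hfil, Finset.sum_singleton, hw]
  exact congrArg G.weight (congrArg (Sym2.map f) hk)

theorem exists_isomorphic_theta (hG : G.IsBicyclic) {p l q : ℕ}
    (hst : Function.Injective fun k => s(thetaSrc p l q k, thetaTgt p l q k))
    {f : Bool ⊕ Fin p ⊕ Fin l ⊕ Fin q → V} (hf : Function.Injective f)
    (hclosed : ∀ x z, G.graph.Adj (f x) z → ∃ y, f y = z)
    (hadj : ∀ k, G.graph.Adj (f (thetaSrc p l q k)) (f (thetaTgt p l q k))) :
    ∃ a b c, G.Isomorphic (theta p l q a b c) := by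
  let w (k : Fin (p + 1) ⊕ Fin (l + 1) ⊕ Fin (q + 1)) : PosReal :=
    ⟨G.weight s(f (thetaSrc p l q k), f (thetaTgt p l q k)), G.weight_pos _ (hadj k)⟩
  refine ⟨fun k => w (.inl k), fun k => w (.inr (.inl k)), fun k => w (.inr (.inr k)), ?_⟩
  rw [theta_eq_ofEdges]
  refine isomorphic_ofEdges hG _ _ hst ?_ hf hclosed hadj _ fun k => ?_
  · simp
    ring
  · rcases k with k | k | k <;> rfl

theorem exists_isomorphic_infty (hG : G.IsBicyclic) {p l q : ℕ} [NeZero l]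
    (hp : p ≠ 0) (hq : q ≠ 0)
    (hst : Function.Injective fun k => s(inftySrc p l q k, inftyTgt p l q k))
    {f : Fin l ⊕ Fin (p - 1) ⊕ Fin (q - 1) → V} (hf : Function.Injective f)
    (hclosed : ∀ x z, G.graph.Adj (f x) z → ∃ y, f y = z)
    (hadj : ∀ k, G.graph.Adj (f (inftySrc p l q k)) (f (inftyTgt p l q k))) :
    ∃ a b c, G.Isomorphic (infty p l q a b c) := by
  let w (k : Fin p ⊕ Fin q ⊕ Fin (l - 1)) : PosReal :=
    ⟨G.weight s(f (inftySrc p l q k), f (inftyTgt p l q k)), G.weight_pos _ (hadj k)⟩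
  refine ⟨fun k => w (.inl k), fun k => w (.inr (.inl k)), fun k => w (.inr (.inr k)), ?_⟩
  rw [infty_eq_ofEdges]
  -- The edge count involves truncated subtractions; it is right because `p`, `q` and `l` are
  -- nonzero.
  have hl := NeZero.ne l
  refine isomorphic_ofEdges hG _ _ hst ?_ hf hclosed hadj _ fun k => ?_
  · simp
    omega
  · rcases k with k | k | k <;> rfl

theorem exists_isomorphic_theta_one_one_one (hG : G.IsBicyclic) {u v x y z : V}
    (hd : [u, v, x, y, z].Nodup) (hu : ∀ w, G.graph.Adj u w ↔ w = x ∨ w = y ∨ w = z)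
    (hv : ∀ w, G.graph.Adj v w ↔ w = x ∨ w = y ∨ w = z)
    (hx : ∀ w, G.graph.Adj x w ↔ w = u ∨ w = v) (hy : ∀ w, G.graph.Adj y w ↔ w = u ∨ w = v)
    (hz : ∀ w, G.graph.Adj z w ↔ w = u ∨ w = v) :
    ∃ a b c, G.Isomorphic (theta 1 1 1 a b c) := by
  refine exists_isomorphic_theta hG (by decide)
    (f := Sum.elim (fun i => if i then v else u) (Sum.elim ![x] (Sum.elim ![y] ![z]))) ?_ ?_ ?_
  · simp at hd
    rintro ((_ | _) | i | i | i) ((_ | _) | j | j | j) h <;> (try fin_cases i) <;>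
      (try fin_cases j) <;> simp at h ⊢ <;> grind
  · clear hd
    simp only [Sum.exists, Bool.exists_bool, Fin.exists_fin_one]
    rintro ((_ | _) | i | i | i) w h <;> (try fin_cases i) <;> simp at h ⊢ <;> grind
  · rintro (i | i | i) <;> fin_cases i <;> simp [thetaSrc, thetaTgt, pathVertex, hu, hx, hy, hz]

theorem exists_isomorphic_theta_one_zero_one (hG : G.IsBicyclic) {u v x y : V}
    (hd : [u, v, x, y].Nodup)
    (hu : ∀ w, G.graph.Adj u w ↔ w = v ∨ w = x ∨ w = y)
    (hv : ∀ w, G.graph.Adj v w ↔ w = u ∨ w = x ∨ w = y)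
    (hx : ∀ w, G.graph.Adj x w ↔ w = u ∨ w = v)
    (hy : ∀ w, G.graph.Adj y w ↔ w = u ∨ w = v) :
    ∃ a b c, G.Isomorphic (theta 1 0 1 a b c) := by
  refine exists_isomorphic_theta hG (by decide)
    (f := Sum.elim (fun i => if i then v else u) (Sum.elim ![x] (Sum.elim ![] ![y]))) ?_ ?_ ?_
  · simp at hd
    rintro ((_ | _) | i | i | i) ((_ | _) | j | j | j) h <;> (try fin_cases i) <;>
      (try fin_cases j) <;> simp at h ⊢ <;> grind
  · clear hd
    simp only [Sum.exists, Bool.exists_bool, Fin.exists_fin_one]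
    rintro ((_ | _) | i | i | i) w h <;> (try fin_cases i) <;> simp at h ⊢ <;> grind
  · rintro (i | i | i) <;> fin_cases i <;> simp [thetaSrc, thetaTgt, pathVertex, hu, hx, hy]

theorem exists_isomorphic_theta_one_zero_two (hG : G.IsBicyclic) {u v x y₁ y₂ : V}
    (hd : [u, v, x, y₁, y₂].Nodup)
    (hu : ∀ w, G.graph.Adj u w ↔ w = v ∨ w = x ∨ w = y₁)
    (hv : ∀ w, G.graph.Adj v w ↔ w = u ∨ w = x ∨ w = y₂)
    (hx : ∀ w, G.graph.Adj x w ↔ w = u ∨ w = v)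
    (hy₁ : ∀ w, G.graph.Adj y₁ w ↔ w = u ∨ w = y₂)
    (hy₂ : ∀ w, G.graph.Adj y₂ w ↔ w = v ∨ w = y₁) :
    ∃ a b c, G.Isomorphic (theta 1 0 2 a b c) := by
  refine exists_isomorphic_theta hG (by decide)
    (f := Sum.elim (fun i => if i then v else u) (Sum.elim ![x] (Sum.elim ![] ![y₁, y₂]))) ?_ ?_ ?_
  · simp at hd
    rintro ((_ | _) | i | i | i) ((_ | _) | j | j | j) h <;> (try fin_cases i) <;>
      (try fin_cases j) <;> simp at h ⊢ <;> grind
  · clear hd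
    simp only [Sum.exists, Bool.exists_bool, Fin.exists_fin_one]
    rintro ((_ | _) | i | i | i) w h <;> (try fin_cases i) <;> simp at h ⊢ <;> grind
  · rintro (i | i | i) <;> fin_cases i <;> simp [thetaSrc, thetaTgt, pathVertex, hu, hx, hy₁, hy₂]

theorem exists_isomorphic_theta_two_zero_two (hG : G.IsBicyclic) {u v x₁ x₂ y₁ y₂ : V}
    (hd : [u, v, x₁, x₂, y₁, y₂].Nodup)
    (hu : ∀ w, G.graph.Adj u w ↔ w = v ∨ w = x₁ ∨ w = y₁)
    (hv : ∀ w, G.graph.Adj v w ↔ w = u ∨ w = x₂ ∨ w = y₂)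
    (hx₁ : ∀ w, G.graph.Adj x₁ w ↔ w = u ∨ w = x₂)
    (hx₂ : ∀ w, G.graph.Adj x₂ w ↔ w = v ∨ w = x₁)
    (hy₁ : ∀ w, G.graph.Adj y₁ w ↔ w = u ∨ w = y₂)
    (hy₂ : ∀ w, G.graph.Adj y₂ w ↔ w = v ∨ w = y₁) :
    ∃ a b c, G.Isomorphic (theta 2 0 2 a b c) := by
  refine exists_isomorphic_theta hG (by decide)
    (f := Sum.elim (fun i => if i then v else u) (Sum.elim ![x₁, x₂] (Sum.elim ![] ![y₁, y₂]))) ?_ ?_ ?_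
  · simp at hd
    rintro ((_ | _) | i | i | i) ((_ | _) | j | j | j) h <;> (try fin_cases i) <;>
      (try fin_cases j) <;> simp at h ⊢ <;> grind
  · clear hd
    simp only [Sum.exists, Bool.exists_bool]
    rintro ((_ | _) | i | i | i) w h <;> (try fin_cases i) <;> simp at h ⊢ <;> grind
  · rintro (i | i | i) <;> fin_cases i <;> simp [thetaSrc, thetaTgt, pathVertex, hu, hx₁, hx₂, hy₁, hy₂]

theorem exists_isomorphic_theta_one_one_two (hG : G.IsBicyclic) {u v x z y₁ y₂ : V}
    (hd : [u, v, x, z, y₁, y₂].Nodup)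
    (hu : ∀ w, G.graph.Adj u w ↔ w = x ∨ w = z ∨ w = y₁)
    (hv : ∀ w, G.graph.Adj v w ↔ w = x ∨ w = z ∨ w = y₂)
    (hx : ∀ w, G.graph.Adj x w ↔ w = u ∨ w = v)
    (hz : ∀ w, G.graph.Adj z w ↔ w = u ∨ w = v)
    (hy₁ : ∀ w, G.graph.Adj y₁ w ↔ w = u ∨ w = y₂)
    (hy₂ : ∀ w, G.graph.Adj y₂ w ↔ w = v ∨ w = y₁) :
    ∃ a b c, G.Isomorphic (theta 1 1 2 a b c) := by
  refine exists_isomorphic_theta hG (by decide)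
    (f := Sum.elim (fun i => if i then v else u) (Sum.elim ![x] (Sum.elim ![z] ![y₁, y₂]))) ?_ ?_ ?_
  · simp at hd
    rintro ((_ | _) | i | i | i) ((_ | _) | j | j | j) h <;> (try fin_cases i) <;>
      (try fin_cases j) <;> simp at h ⊢ <;> grind
  · clear hd
    simp only [Sum.exists, Bool.exists_bool, Fin.exists_fin_one]
    rintro ((_ | _) | i | i | i) w h <;> (try fin_cases i) <;> simp at h ⊢ <;> grind
  · rintro (i | i | i) <;> fin_cases i <;> simp [thetaSrc, thetaTgt, pathVertex, hu, hx, hz, hy₁, hy₂]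

theorem exists_isomorphic_infty_four_one_four (hG : G.IsBicyclic) {v x₁ x₂ x₃ y₁ y₂ y₃ : V}
    (hd : [v, x₁, x₂, x₃, y₁, y₂, y₃].Nodup)
    (hv : ∀ w, G.graph.Adj v w ↔ w = x₁ ∨ w = x₃ ∨ w = y₁ ∨ w = y₃)
    (hx₁ : ∀ w, G.graph.Adj x₁ w ↔ w = v ∨ w = x₂)
    (hx₂ : ∀ w, G.graph.Adj x₂ w ↔ w = x₁ ∨ w = x₃)
    (hx₃ : ∀ w, G.graph.Adj x₃ w ↔ w = v ∨ w = x₂)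
    (hy₁ : ∀ w, G.graph.Adj y₁ w ↔ w = v ∨ w = y₂)
    (hy₂ : ∀ w, G.graph.Adj y₂ w ↔ w = y₁ ∨ w = y₃)
    (hy₃ : ∀ w, G.graph.Adj y₃ w ↔ w = v ∨ w = y₂) :
    ∃ a b c, G.Isomorphic (infty 4 1 4 a b c) := by
  refine exists_isomorphic_infty hG (by decide) (by decide) (by decide)
    (f := Sum.elim ![v] (Sum.elim ![x₁, x₂, x₃] ![y₁, y₂, y₃])) ?_ ?_ ?_
  · simp at hd
    rintro (i | i | i) (j | j | j) h <;> (try fin_cases i) <;>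
      (try fin_cases j) <;> simp at h ⊢ <;> grind
  · clear hd
    change ∀ (x : Fin 1 ⊕ Fin 3 ⊕ Fin 3) (z : V), _ → ∃ y : Fin 1 ⊕ Fin 3 ⊕ Fin 3, _ = z
    simp only [Sum.exists, Fin.exists_fin_succ, Fin.exists_fin_zero]
    rintro (i | i | i) w h <;> (try fin_cases i) <;> simp at h ⊢ <;> grind
  · rintro (i | i | i) <;> fin_cases i <;> simp [inftySrc, inftyTgt, pathVertex, hv, hx₁, hx₂, hx₃, hy₁, hy₂, hy₃]

end Construction

/-! ### Explicit neighbourhoods, known neighbours listed first -/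

section Neighbors

variable {V : Type*} {Γ : SimpleGraph V}

theorem adj_iff_of_ncard_two {a p : V} (h : (Γ.neighborSet a).ncard = 2) (hp : Γ.Adj a p) :
    ∃ q, q ≠ p ∧ Γ.Adj a q ∧ ∀ w, Γ.Adj a w ↔ w = p ∨ w = q := by
  obtain ⟨x, y, hxy, hs⟩ := Set.ncard_eq_two.1 h
  have hw (w : V) : Γ.Adj a w ↔ w = x ∨ w = y := by
    rw [← SimpleGraph.mem_neighborSet, hs]
    simp
  rcases (hw p).1 hp with rfl | rfl
  · exact ⟨y, hxy.symm, by grind, hw⟩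
  · exact ⟨x, hxy, by grind, by grind⟩

theorem adj_iff_of_ncard_three {a : V} (h : (Γ.neighborSet a).ncard = 3) :
    ∃ p q r, p ≠ q ∧ p ≠ r ∧ q ≠ r ∧ ∀ w, Γ.Adj a w ↔ w = p ∨ w = q ∨ w = r := by
  obtain ⟨x, y, z, hxy, hxz, hyz, hs⟩ := Set.ncard_eq_three.1 h
  refine ⟨x, y, z, hxy, hxz, hyz, fun w => ?_⟩
  rw [← SimpleGraph.mem_neighborSet, hs]
  simp

theorem adj_iff_of_ncard_three_of_adj {a p : V} (h : (Γ.neighborSet a).ncard = 3)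
    (hp : Γ.Adj a p) :
    ∃ q r, p ≠ q ∧ p ≠ r ∧ q ≠ r ∧ ∀ w, Γ.Adj a w ↔ w = p ∨ w = q ∨ w = r := by
  obtain ⟨x, y, z, hxy, hxz, hyz, hw⟩ := adj_iff_of_ncard_three h
  rcases (hw p).1 hp with rfl | rfl | rfl
  · exact ⟨y, z, hxy, hxz, hyz, hw⟩
  · exact ⟨x, z, hxy.symm, hyz, hxz, by grind⟩
  · exact ⟨x, y, hxz.symm, hyz.symm, hxy, by grind⟩

theorem adj_iff_of_ncard_three_of_adj_of_adj {a p q : V} (h : (Γ.neighborSet a).ncard = 3)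
    (hp : Γ.Adj a p) (hq : Γ.Adj a q) (hpq : p ≠ q) :
    ∃ r, p ≠ r ∧ q ≠ r ∧ ∀ w, Γ.Adj a w ↔ w = p ∨ w = q ∨ w = r := by
  obtain ⟨x, y, hpx, hpy, hxy, hw⟩ := adj_iff_of_ncard_three_of_adj h hp
  rcases (hw q).1 hq with h | rfl | rfl
  · exact absurd h.symm hpq
  · exact ⟨y, hpy, hxy, hw⟩
  · exact ⟨x, hpx, hxy.symm, by grind⟩

theorem adj_iff_of_ncard_four {a : V} (h : (Γ.neighborSet a).ncard = 4) :
    ∃ p q r s, [p, q, r, s].Nodup ∧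
      ∀ w, Γ.Adj a w ↔ w = p ∨ w = q ∨ w = r ∨ w = s := by
  obtain ⟨p, t, hp, ht, h3⟩ := Set.eq_insert_of_ncard_eq_succ h
  obtain ⟨x, y, z, hxy, hxz, hyz, rfl⟩ := Set.ncard_eq_three.1 h3
  refine ⟨p, x, y, z, ?_, fun w => ?_⟩
  · simp at hp
    simp
    grind
  · rw [← SimpleGraph.mem_neighborSet, ← ht]
    simp

end Neighbors

/-! ### Degrees in a bicyclic graph without pendants -/

section Degrees

variable {V : Type*} [Fintype V] {G : WeightedGraph V}

/-- In a bicyclic graph without pendants, either one vertex has degree four, or two vertices have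
degree three; all others have degree two. -/
theorem IsBicyclic.degrees (hG : G.IsBicyclic) (hpend : ¬ G.HasPendant) :
    (∃ v, (G.graph.neighborSet v).ncard = 4 ∧
      ∀ w, w ≠ v → (G.graph.neighborSet w).ncard = 2) ∨
    ∃ u v, u ≠ v ∧ (G.graph.neighborSet u).ncard = 3 ∧ (G.graph.neighborSet v).ncard = 3 ∧
      ∀ w, w ≠ u → w ≠ v → (G.graph.neighborSet w).ncard = 2 := by
  classical
  have hdeg (v : V) : (G.graph.neighborSet v).ncard = G.graph.degree v := by
    rw [Set.ncard_eq_toFinset_card', ← SimpleGraph.card_neighborFinset_eq_degree]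
    rfl
  have hedges : G.graph.edgeFinset.card = Fintype.card V + 1 := by
    rw [← Nat.card_eq_fintype_card, ← hG.2, Set.ncard_eq_toFinset_card']
    rfl
  have hnt : Nontrivial V := by
    by_contra hn
    rw [not_nontrivial_iff_subsingleton] at hn
    have : G.graph.edgeFinset = ∅ := by
      ext e
      induction e with
      | _ x y => simp [Subsingleton.elim x y]
    simp [this] at hedges
  have hge (v : V) : 2 ≤ G.graph.degree v := by
    have h1 : 0 < G.graph.degree v := hG.1.preconnected.degree_pos_of_nontrivial v
    have h2 : G.graph.degree v ≠ 1 := fun h => hpend ⟨v, (hdeg v).trans h⟩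
    omega
  simp only [hdeg]
  -- The degrees sum to twice the number of edges, `2|V| + 2`, and `hge` makes the subtraction
  -- exact.
  have hsum : ∑ v, (G.graph.degree v - 2) = 2 := by
    have h1 := G.graph.sum_degrees_eq_twice_card_edges
    have h2 : ∑ v, G.graph.degree v = ∑ v, (G.graph.degree v - 2) + ∑ _v : V, 2 := by
      rw [← Finset.sum_add_distrib]
      exact Finset.sum_congr rfl fun v _ => (Nat.sub_add_cancel (hge v)).symm
    simp at h2
    omega
  obtain ⟨u, -, hu⟩ : ∃ u ∈ Finset.univ, G.graph.degree u - 2 ≠ 0 :=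
    Finset.exists_ne_zero_of_sum_ne_zero (by omega)
  rw [← Finset.add_sum_erase _ _ (Finset.mem_univ u)] at hsum
  by_cases hu2 : G.graph.degree u - 2 = 2
  · left
    refine ⟨u, by omega, fun w hw => ?_⟩
    have h0 : ∑ v ∈ Finset.univ.erase u, (G.graph.degree v - 2) = 0 := by omega
    have := Finset.sum_eq_zero_iff.1 h0 w (by simp [hw])
    have := hge w
    omega
  · right
    have h1 : ∑ v ∈ Finset.univ.erase u, (G.graph.degree v - 2) = 1 := by omega
    obtain ⟨v, hv, hv0⟩ : ∃ v ∈ Finset.univ.erase u, G.graph.degree v - 2 ≠ 0 :=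
      Finset.exists_ne_zero_of_sum_ne_zero (by omega)
    rw [← Finset.add_sum_erase _ _ hv] at h1
    refine ⟨u, v, (Finset.ne_of_mem_erase hv).symm, by omega, by omega, fun w hwu hwv => ?_⟩
    have h0 : ∑ v ∈ (Finset.univ.erase u).erase v, (G.graph.degree v - 2) = 0 := by omega
    have := Finset.sum_eq_zero_iff.1 h0 w (by simp [hwu, hwv])
    have := hge w
    omega

end Degrees

/-! ### One vertex of degree four -/

section Classification

variable {V : Type*} [Fintype V] [DecidableEq V] {G : WeightedGraph V}

theorem exists_isomorphic_of_degree_four (hG : G.IsBicyclic) (hlt : G.negIndex < 3) {v : V}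
    (h4 : (G.graph.neighborSet v).ncard = 4)
    (h2 : ∀ w, w ≠ v → (G.graph.neighborSet w).ncard = 2) :
    ∃ a b c, G.Isomorphic (infty 4 1 4 a b c) := by
  have hs : ∀ x y, G.graph.Adj x y → G.graph.Adj y x := fun _ _ h => h.symm
  have hirr : ∀ x, ¬ G.graph.Adj x x := G.graph.loopless.irrefl
  have nbr {a : V} (h : G.graph.Adj v a) :
      ∃ b, b ≠ v ∧ G.graph.Adj a b ∧ ∀ w, G.graph.Adj a w ↔ w = v ∨ w = b :=
    adj_iff_of_ncard_two (h2 a h.ne') h.symm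
  obtain ⟨x₁, x₂, x₃, x₄, hd, hv⟩ := adj_iff_of_ncard_four h4
  simp at hd
  -- A triangle `v a b` leaves another neighbour `c` of `v`. Its second neighbour either closes a
  -- bowtie or is the far end of an edge beside the triangle.
  have hfree (a b : V) (ha : G.graph.Adj v a) (hb : G.graph.Adj v b) : ¬ G.graph.Adj a b := by
    intro hab
    obtain ⟨a', -, -, hNa⟩ := nbr ha
    obtain ⟨b', -, -, hNb⟩ := nbr hb
    obtain ⟨c, hc, hca, hcb⟩ : ∃ c, G.graph.Adj v c ∧ c ≠ a ∧ c ≠ b := by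
      by_contra! hn
      have := hn x₁
      have := hn x₂
      have := hn x₃
      grind
    obtain ⟨c', hc', hcc, hNc⟩ := nbr hc
    obtain rfl : b = a' := ((hNa b).1 hab).resolve_left hb.ne'
    obtain rfl : a = b' := ((hNb a).1 hab.symm).resolve_left ha.ne'
    clear nbr h2 hv hd hG h4
    have hac : ¬ G.graph.Adj a c := by grind
    have hbc : ¬ G.graph.Adj b c := by grind
    have hac' : ¬ G.graph.Adj a c' := by grind
    have hbc' : ¬ G.graph.Adj b c' := by grind
    by_cases h : G.graph.Adj v c'
    · have := G.three_le_negIndex_of_bowtie ha hb hc h hab hcc hac hac' hbc hbc'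
      omega
    · have := G.three_le_negIndex_of_triangle_edge ha hab hb.symm hcc (mt (hs _ _) h)
        (mt (hs _ _) hac') (mt (hs _ _) hbc')
      omega
  -- Three neighbours of `v` with distinct second neighbours would form a triangular (here diagonal)
  -- configuration.
  have hpair (a b c a' b' c' : V) (ha : G.graph.Adj v a) (hb : G.graph.Adj v b)
      (hc : G.graph.Adj v c) (hNa : ∀ w, G.graph.Adj a w ↔ w = v ∨ w = a')
      (hNb : ∀ w, G.graph.Adj b w ↔ w = v ∨ w = b')
      (hNc : ∀ w, G.graph.Adj c w ↔ w = v ∨ w = c') (hav : a' ≠ v) (hbv : b' ≠ v)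
      (hcv : c' ≠ v) : a' = b' ∨ a' = c' ∨ b' = c' := by
    by_contra! hne
    have := G.three_le_negIndex_of_triangular (hfree a b ha hb) (hfree a c ha hc)
      (hfree b c hb hc) (y₁ := a') (y₂ := b') (y₃ := c') (by grind) (by grind) (by grind)
      (by grind) (by grind) (by grind)
    omega
  -- Once `a` and `b` share the second neighbour `e`, its degree is used up, so `hpair` for `a, c,
  -- d` makes `c` and `d` share theirs.
  have hfinal (a b c d e : V) (hd : [a, b, c, d].Nodup)
      (hv : ∀ w, G.graph.Adj v w ↔ w = a ∨ w = b ∨ w = c ∨ w = d) (hev : e ≠ v)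
      (hNa : ∀ w, G.graph.Adj a w ↔ w = v ∨ w = e)
      (hNb : ∀ w, G.graph.Adj b w ↔ w = v ∨ w = e) :
      ∃ a b c, G.Isomorphic (infty 4 1 4 a b c) := by
    simp at hd
    obtain ⟨c', hc', hcc, hNc⟩ := nbr ((hv c).2 (by simp))
    obtain ⟨d', hd', hdd, hNd⟩ := nbr ((hv d).2 (by simp))
    obtain ⟨a', -, -, hNe⟩ := adj_iff_of_ncard_two (h2 e hev) (p := a) (by grind)
    obtain rfl : b = a' := ((hNe b).1 ((hNb e).2 (Or.inr rfl)).symm).resolve_left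
      (Ne.symm hd.1.1)
    have hcd : c' = d' := by
      rcases hpair a c d e c' d' (by grind) (by grind) (by grind) hNa hNc hNd hev hc' hd' with
        h | h | h
      · grind
      · grind
      · exact h
    subst hcd
    obtain ⟨f, -, hcf, hNf⟩ := adj_iff_of_ncard_two (h2 c' hc') (p := c) (by grind)
    have hfd : f = d := by grind
    subst hfd
    have f1 := hfree a b (by grind) (by grind)
    have f2 := hfree c f (by grind) (by grind)
    have f3 := hfree a e (by grind)
    have f4 := hfree c c' (by grind)
    exact exists_isomorphic_infty_four_one_four hG (v := v) (x₁ := a) (x₂ := e) (x₃ := b)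
      (y₁ := c) (y₂ := c') (y₃ := f) (by simp; grind) (by grind) (by grind) (by grind) (by grind)
      (by grind) (by grind) (by grind)
  obtain ⟨y₁, hy₁, -, hN₁⟩ := nbr ((hv x₁).2 (by simp))
  obtain ⟨y₂, hy₂, -, hN₂⟩ := nbr ((hv x₂).2 (by simp))
  obtain ⟨y₃, hy₃, -, hN₃⟩ := nbr ((hv x₃).2 (by simp))
  rcases hpair x₁ x₂ x₃ y₁ y₂ y₃ (by grind) (by grind) (by grind) hN₁ hN₂ hN₃ hy₁ hy₂ hy₃ with
    rfl | rfl | rfl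
  · exact hfinal x₁ x₂ x₃ x₄ y₁ (by simp; grind) hv hy₁ hN₁ hN₂
  · exact hfinal x₁ x₃ x₂ x₄ y₁ (by simp; grind) (by grind) hy₁ hN₁ hN₃
  · exact hfinal x₂ x₃ x₁ x₄ y₂ (by simp; grind) (by grind) hy₂ hN₂ hN₃

end Classification

/-! ### Two vertices of degree three -/

section Classification

variable {V : Type*} [Fintype V] [DecidableEq V] {G : WeightedGraph V}

/-- If `c` and `d` are not adjacent, the edge from `c` to its second neighbour lies beside the
triangle `u v x`. -/
theorem exists_isomorphic_of_adj_of_common (hG : G.IsBicyclic) (hlt : G.negIndex < 3)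
    {u v x c d : V} (huv : u ≠ v) (hxc : x ≠ c) (hvc : v ≠ c) (hxd : x ≠ d) (hud : u ≠ d)
    (hvx : v ≠ x) (hux : u ≠ x) (hcd : c ≠ d)
    (hu : ∀ w, G.graph.Adj u w ↔ w = v ∨ w = x ∨ w = c)
    (hv : ∀ w, G.graph.Adj v w ↔ w = u ∨ w = x ∨ w = d)
    (h2 : ∀ w, w ≠ u → w ≠ v → (G.graph.neighborSet w).ncard = 2) :
    ∃ a b c, G.Isomorphic (theta 1 0 2 a b c) := by
  have hs : ∀ x y, G.graph.Adj x y → G.graph.Adj y x := fun _ _ h => h.symm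
  have auv : G.graph.Adj u v := by grind
  have aux : G.graph.Adj u x := by grind
  have avx : G.graph.Adj v x := by grind
  have auc : G.graph.Adj u c := by grind
  have avd : G.graph.Adj v d := by grind
  obtain ⟨x', hx', axx, hNx⟩ := adj_iff_of_ncard_two (h2 x hux.symm hvx.symm) aux.symm
  obtain ⟨c', hc', acc, hNc⟩ := adj_iff_of_ncard_two (h2 c auc.ne' hvc.symm) auc.symm
  obtain ⟨d', hd', add, hNd⟩ := adj_iff_of_ncard_two (h2 d hud.symm avd.ne') avd.symm
  clear h2
  obtain rfl : v = x' := ((hNx v).1 avx.symm).resolve_left huv.symm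
  by_cases h : G.graph.Adj c d
  · exact exists_isomorphic_theta_one_zero_two hG (u := u) (v := v) (x := x) (y₁ := c) (y₂ := d)
      (by have := auc.ne; have := avd.ne; simp; grind) hu hv hNx (by grind) (by grind)
  · have hcv : ¬ G.graph.Adj c v := by grind
    have hcx : ¬ G.graph.Adj c x := by grind
    have hcc := acc.ne
    have hcu : ¬ G.graph.Adj u c' := by grind
    have hcv' : ¬ G.graph.Adj v c' := by grind
    have hcx' : ¬ G.graph.Adj x c' := by grind
    have := G.three_le_negIndex_of_triangle_edge auv avx aux.symm acc (mt (hs _ _) hcu)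
      (mt (hs _ _) hcv') (mt (hs _ _) hcx')
    omega

theorem exists_isomorphic_of_adj_of_disjoint (hG : G.IsBicyclic) (hlt : G.negIndex < 3)
    {u v a b c d : V} (hd : [u, v, a, b, c, d].Nodup)
    (hu : ∀ w, G.graph.Adj u w ↔ w = v ∨ w = a ∨ w = c)
    (hv : ∀ w, G.graph.Adj v w ↔ w = u ∨ w = b ∨ w = d)
    (h2 : ∀ w, w ≠ u → w ≠ v → (G.graph.neighborSet w).ncard = 2) :
    ∃ a b c, G.Isomorphic (theta 2 0 2 a b c) := by
  have hs : ∀ x y, G.graph.Adj x y → G.graph.Adj y x := fun _ _ h => h.symm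
  -- One edge between the outer neighbours of `u` and of `v` forces the complementary one, since
  -- otherwise `c, d, a` against `u, v, b` is triangular.
  have key (a b c d : V) (hd : [u, v, a, b, c, d].Nodup)
      (hu : ∀ w, G.graph.Adj u w ↔ w = v ∨ w = a ∨ w = c)
      (hv : ∀ w, G.graph.Adj v w ↔ w = u ∨ w = b ∨ w = d) (hac : ¬ G.graph.Adj a c)
      (hbd : ¬ G.graph.Adj b d) (hab : G.graph.Adj a b) :
      ∃ a b c, G.Isomorphic (theta 2 0 2 a b c) := by
    have hd' := hd
    simp at hd'
    have auc : G.graph.Adj u c := by grind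
    have avd : G.graph.Adj v d := by grind
    have aua : G.graph.Adj u a := by grind
    have avb : G.graph.Adj v b := by grind
    obtain ⟨b', -, -, hNa⟩ := adj_iff_of_ncard_two (h2 a (by grind) (by grind)) aua.symm
    obtain ⟨a', -, -, hNb⟩ := adj_iff_of_ncard_two (h2 b (by grind) (by grind)) avb.symm
    obtain ⟨d', -, -, hNc⟩ := adj_iff_of_ncard_two (h2 c (by grind) (by grind)) auc.symm
    obtain ⟨c', -, -, hNd⟩ := adj_iff_of_ncard_two (h2 d (by grind) (by grind)) avd.symm
    obtain rfl : b = b' := ((hNa b).1 hab).resolve_left (by grind)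
    obtain rfl : a = a' := ((hNb a).1 hab.symm).resolve_left (by grind)
    clear h2
    by_cases hcd : G.graph.Adj c d
    · exact exists_isomorphic_theta_two_zero_two hG hd hu hv hNa (by grind) (by grind) (by grind)
    · have h1 : ¬ G.graph.Adj d u := by grind
      have h2 : ¬ G.graph.Adj c v := by grind
      have h3 : ¬ G.graph.Adj a d := by grind
      have h4 : ¬ G.graph.Adj b c := by grind
      have := G.three_le_negIndex_of_triangular hcd (mt (hs _ _) hac) (mt (hs _ _) h3) auc.symm
        avd.symm hab h2 (mt (hs _ _) h4) (mt (hs _ _) hbd)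
      omega
  have hd' := hd
  simp at hd'
  obtain ⟨⟨huv, hua, hub, huc, hud⟩, ⟨hva, hvb, hvc, hvd⟩, ⟨hab, hac, had⟩, ⟨hbc, hbd⟩, hcd⟩ := hd'
  have auv : G.graph.Adj u v := by grind
  have aua : G.graph.Adj u a := by grind
  have auc : G.graph.Adj u c := by grind
  have avb : G.graph.Adj v b := by grind
  have avd : G.graph.Adj v d := by grind
  obtain ⟨a', ha', aaa, hNa⟩ := adj_iff_of_ncard_two (h2 a (Ne.symm hua) (Ne.symm hva)) aua.symm
  obtain ⟨b', hb', abb, hNb⟩ := adj_iff_of_ncard_two (h2 b (Ne.symm hub) (Ne.symm hvb)) avb.symm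
  obtain ⟨c', hc', acc, hNc⟩ := adj_iff_of_ncard_two (h2 c (Ne.symm huc) (Ne.symm hvc)) auc.symm
  obtain ⟨d', hd', add, hNd⟩ := adj_iff_of_ncard_two (h2 d (Ne.symm hud) (Ne.symm hvd)) avd.symm
  have hnac : ¬ G.graph.Adj a c := by
    intro h
    clear h2 key hd hNd
    have h1 : ¬ G.graph.Adj u b := by grind
    have h3 : ¬ G.graph.Adj a b := by grind
    have h4 : ¬ G.graph.Adj c b := by grind
    have := G.three_le_negIndex_of_triangle_edge aua h auc.symm avb (mt (hs _ _) h1)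
      (mt (hs _ _) h3) (mt (hs _ _) h4)
    omega
  have hnbd : ¬ G.graph.Adj b d := by
    intro h
    clear h2 key hd hNc
    have h1 : ¬ G.graph.Adj v a := by grind
    have h3 : ¬ G.graph.Adj b a := by grind
    have h4 : ¬ G.graph.Adj d a := by grind
    have := G.three_le_negIndex_of_triangle_edge avb h avd.symm aua (mt (hs _ _) h1)
      (mt (hs _ _) h3) (mt (hs _ _) h4)
    omega
  by_cases h : G.graph.Adj a b
  · exact key a b c d hd hu hv hnac hnbd h
  by_cases h' : G.graph.Adj a d
  · exact key a d c b (by simp; grind) hu (by grind) hnac (mt (hs _ _) hnbd) h'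
  by_cases hcb : G.graph.Adj c b
  · exact key c b a d (by simp; grind) (by grind) hv (mt (hs _ _) hnac) hnbd hcb
  exfalso
  clear key hd hNd add hd' auc
  have h1 : ¬ G.graph.Adj u b := by grind
  have h3 : ¬ G.graph.Adj a v := by grind
  have h4 : ¬ G.graph.Adj c v := by grind
  -- If `a` and `c` share the second neighbour `a'`, its degree is exhausted and `a', u, b` is
  -- triangular against `a, v, b'`. Otherwise `c, a, b` is, against `u, a', v`.
  by_cases hca : G.graph.Adj c a'
  · obtain ⟨c'', -, -, hN⟩ :=
      adj_iff_of_ncard_two (h2 a' ha' (fun h => h3 (h ▸ aaa))) aaa.symm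
    obtain rfl : c = c'' := ((hN c).1 hca.symm).resolve_left (Ne.symm hac)
    clear h2
    have := G.three_le_negIndex_of_triangular (x₁ := a') (x₂ := u) (x₃ := b) (y₁ := a) (y₂ := v)
      (y₃ := b') (by grind) (by grind) h1 aaa.symm auv abb (by grind) (by grind) (by grind)
    omega
  · clear h2
    have := G.three_le_negIndex_of_triangular (mt (hs _ _) hnac) hcb h (hs _ _ ((hu c).2 (by simp)))
      aaa avb.symm hca h4 h3
    omega

theorem exists_isomorphic_of_adj (hG : G.IsBicyclic) (hlt : G.negIndex < 3)
    {u v : V} (huv : G.graph.Adj u v) (hu : (G.graph.neighborSet u).ncard = 3)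
    (hv : (G.graph.neighborSet v).ncard = 3)
    (h2 : ∀ w, w ≠ u → w ≠ v → (G.graph.neighborSet w).ncard = 2) :
    (∃ a b c, G.Isomorphic (theta 1 0 1 a b c)) ∨ (∃ a b c, G.Isomorphic (theta 1 0 2 a b c)) ∨
      ∃ a b c, G.Isomorphic (theta 2 0 2 a b c) := by
  have hne := huv.ne
  by_cases hx : ∃ x, G.graph.Adj u x ∧ G.graph.Adj v x
  · obtain ⟨x, hux, hvx⟩ := hx
    obtain ⟨c, hvc, hxc, hNu⟩ := adj_iff_of_ncard_three_of_adj_of_adj hu huv hux hvx.ne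
    obtain ⟨d, hud, hxd, hNv⟩ := adj_iff_of_ncard_three_of_adj_of_adj hv huv.symm hvx hux.ne
    by_cases hcd : c = d
    · left
      subst hcd
      have huc : G.graph.Adj u c := (hNu c).2 (by simp)
      have hvc' : G.graph.Adj v c := (hNv c).2 (by simp)
      obtain ⟨v₁, -, -, hNx⟩ := adj_iff_of_ncard_two (h2 x hux.ne' hvx.ne') hux.symm
      obtain ⟨v₂, -, -, hNc⟩ := adj_iff_of_ncard_two (h2 c huc.ne' hvc'.ne') huc.symm
      obtain rfl : v = v₁ := ((hNx v).1 hvx.symm).resolve_left hne.symm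
      obtain rfl : v = v₂ := ((hNc v).1 hvc'.symm).resolve_left hne.symm
      exact exists_isomorphic_theta_one_zero_one hG
        (by simp [hne, hux.ne, hvx.ne, huc.ne, hvc'.ne, hxc]) hNu hNv hNx hNc
    · exact .inr (.inl (exists_isomorphic_of_adj_of_common hG hlt hne hxc hvc hxd hud hvx.ne
        hux.ne hcd hNu hNv h2))
  · right
    right
    obtain ⟨a, c, hva, hvc, hac, hNu⟩ := adj_iff_of_ncard_three_of_adj hu huv
    obtain ⟨b, d, hub, hud, hbd, hNv⟩ := adj_iff_of_ncard_three_of_adj hv huv.symm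
    have hirr := G.graph.loopless.irrefl
    have hu' := hirr u
    have hv' := hirr v
    have ha := (hNu a).2 (by simp)
    have hc := (hNu c).2 (by simp)
    have hb := (hNv b).2 (by simp)
    have hd := (hNv d).2 (by simp)
    push Not at hx
    have hxa := hx a ha
    have hxc := hx c hc
    clear hirr hx
    exact exists_isomorphic_of_adj_of_disjoint hG hlt (by simp; grind) hNu hNv h2

theorem three_le_negIndex_of_no_common {u v : V} (huv : u ≠ v) (hadj : ¬ G.graph.Adj u v)
    (hcom : ∀ x, G.graph.Adj u x → ¬ G.graph.Adj v x) (hu : (G.graph.neighborSet u).ncard = 3)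
    (hv : (G.graph.neighborSet v).ncard = 3)
    (h2 : ∀ w, w ≠ u → w ≠ v → (G.graph.neighborSet w).ncard = 2) : 3 ≤ G.negIndex := by
  by_contra hlt
  have hs : ∀ x y, G.graph.Adj x y → G.graph.Adj y x := fun _ _ h => h.symm
  have hneu {a : V} (ha : G.graph.Adj u a) : a ≠ v := by
    rintro rfl
    exact hadj ha
  have hnev {a : V} (ha : G.graph.Adj v a) : a ≠ u := by
    rintro rfl
    exact hadj ha.symm
  obtain ⟨a₁, a₂, a₃, ha₁₂, ha₁₃, ha₂₃, hNu⟩ := adj_iff_of_ncard_three hu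
  obtain ⟨b₁, b₂, b₃, hb₁₂, hb₁₃, hb₂₃, hNv⟩ := adj_iff_of_ncard_three hv
  have ha₁ := (hNu a₁).2 (by simp)
  have ha₂ := (hNu a₂).2 (by simp)
  have ha₃ := (hNu a₃).2 (by simp)
  have hb₁ := (hNv b₁).2 (by simp)
  have hfreeu (a c : V) (ha : G.graph.Adj u a) (hc : G.graph.Adj u c) : ¬ G.graph.Adj a c :=
    fun h => hlt (G.three_le_negIndex_of_triangle_edge ha h hc.symm hb₁.symm (mt (hs _ _) hadj)
      (hcom a ha) (hcom c hc))
  have hfreev (b d : V) (hb : G.graph.Adj v b) (hd : G.graph.Adj v d) : ¬ G.graph.Adj b d :=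
    fun h => hlt (G.three_le_negIndex_of_triangle_edge hb h hd.symm ha₁.symm hadj
      (fun h => hcom b h hb) (fun h => hcom d h hd))
  have hcross (a b : V) (ha : G.graph.Adj u a) (hb : G.graph.Adj v b) : ¬ G.graph.Adj a b := by
    intro hab
    obtain ⟨c, hc, hca⟩ : ∃ c, G.graph.Adj u c ∧ c ≠ a := by
      by_cases h : a₁ = a
      · exact ⟨a₂, ha₂, fun h' => ha₁₂ (h.trans h'.symm)⟩
      · exact ⟨a₁, ha₁, h⟩
    obtain ⟨c', -, -, hNc⟩ := adj_iff_of_ncard_two (h2 c hc.ne' (hneu hc)) hc.symm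
    -- Two of the three neighbours of `v` differ from `b`, and at most one of them is the second
    -- neighbour of `c`.
    obtain ⟨d, hd, hdb, hdc⟩ : ∃ d, G.graph.Adj v d ∧ d ≠ b ∧ d ≠ c' := by
      by_contra! hn
      have e₁ := hn b₁ hb₁
      have e₂ := hn b₂ ((hNv b₂).2 (by simp))
      have e₃ := hn b₃ ((hNv b₃).2 (by simp))
      clear hn hfreeu hfreev hcom h2
      grind
    obtain ⟨b', -, -, hNa⟩ := adj_iff_of_ncard_two (h2 a ha.ne' (hneu ha)) ha.symm
    obtain ⟨a', -, -, hNb⟩ := adj_iff_of_ncard_two (h2 b (hnev hb) hb.ne') hb.symm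
    obtain rfl : b = b' := ((hNa b).1 hab).resolve_left (hnev hb)
    obtain rfl : a = a' := ((hNb a).1 hab.symm).resolve_left (hneu ha)
    have hcd : ¬ G.graph.Adj c d := by
      rw [hNc]
      simp [hnev hd, hdc]
    have hcb : ¬ G.graph.Adj b c := by
      rw [hNb]
      simp [hneu hc, hca]
    have had : ¬ G.graph.Adj a d := by
      rw [hNa]
      simp [hnev hd, hdb]
    exact hlt (G.three_le_negIndex_of_triangular hcd (hfreeu c a hc ha) (mt (hs _ _) had)
      hc.symm hd.symm hab (mt (hs _ _) (hcom c hc)) (mt (hs _ _) hcb) (hfreev d b hd hb))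
  -- Hence a second neighbour of one neighbour of `u` is joined to all three, against its degree
  -- two.
  have hnbr (a c w : V) (ha : G.graph.Adj u a) (hc : G.graph.Adj u c) (hwu : w ≠ u)
      (haw : G.graph.Adj a w) : G.graph.Adj c w := by
    by_contra hcw
    exact hlt (G.three_le_negIndex_of_triangular (hfreeu c a hc ha) (hcross c b₁ hc hb₁)
      (hcross a b₁ ha hb₁) hc.symm haw hb₁.symm hcw (mt (hs _ _) (hcom c hc))
      (mt (hs _ _) (hcom a ha)))
  obtain ⟨w, hwu, haw, -⟩ := adj_iff_of_ncard_two (h2 a₁ ha₁.ne' (hneu ha₁)) ha₁.symm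
  have hwv : w ≠ v := by
    rintro rfl
    exact hcom a₁ ha₁ haw.symm
  obtain ⟨q, -, -, hNw⟩ := adj_iff_of_ncard_two (h2 w hwu hwv) haw.symm
  have e₂ := (hNw a₂).1 (hnbr a₁ a₂ w ha₁ ha₂ hwu haw).symm
  have e₃ := (hNw a₃).1 (hnbr a₁ a₃ w ha₁ ha₃ hwu haw).symm
  clear hcross hnbr hfreeu hfreev hcom h2
  grind

theorem three_le_negIndex_of_one_common {u v x a b c d : V} (hd : [u, v, x, a, b, c, d].Nodup)
    (hu : ∀ w, G.graph.Adj u w ↔ w = x ∨ w = a ∨ w = c)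
    (hv : ∀ w, G.graph.Adj v w ↔ w = x ∨ w = b ∨ w = d)
    (h2 : ∀ w, w ≠ u → w ≠ v → (G.graph.neighborSet w).ncard = 2) : 3 ≤ G.negIndex := by
  by_contra hlt
  have hs : ∀ x y, G.graph.Adj x y → G.graph.Adj y x := fun _ _ h => h.symm
  have hd' := hd
  simp at hd'
  have huv : ¬ G.graph.Adj u v := by grind
  have hva : ¬ G.graph.Adj v a := by grind
  have hvc : ¬ G.graph.Adj v c := by grind
  have hub : ¬ G.graph.Adj u b := by grind
  have hud : ¬ G.graph.Adj u d := by grind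
  have aux : G.graph.Adj u x := by grind
  have avx : G.graph.Adj v x := by grind
  have aua : G.graph.Adj u a := by grind
  have auc : G.graph.Adj u c := by grind
  have avb : G.graph.Adj v b := by grind
  have avd : G.graph.Adj v d := by grind
  have hac : ¬ G.graph.Adj a c := fun h => hlt (G.three_le_negIndex_of_triangle_edge aua h
    auc.symm avx.symm (mt (hs _ _) huv) hva hvc)
  have hbd : ¬ G.graph.Adj b d := fun h => hlt (G.three_le_negIndex_of_triangle_edge avb h
    avd.symm aux.symm huv hub hud)
  have key (a b c d : V) (hd : [u, v, a, b, c, d].Nodup) (aua : G.graph.Adj u a)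
      (auc : G.graph.Adj u c) (avb : G.graph.Adj v b) (avd : G.graph.Adj v d)
      (hac : ¬ G.graph.Adj a c) (hbd : ¬ G.graph.Adj b d) (hva : ¬ G.graph.Adj v a)
      (hvc : ¬ G.graph.Adj v c) (hub : ¬ G.graph.Adj u b) (hud : ¬ G.graph.Adj u d) :
      -- With `a` and `b` adjacent, an edge `cd` completes the hexagon `u a b v d c`; without it,
      -- `c, d, a` is triangular against `u, v, b`.
      ¬ G.graph.Adj a b := by
    intro hab
    simp at hd
    obtain ⟨b', -, -, hNa⟩ := adj_iff_of_ncard_two (h2 a (by grind) (by grind)) aua.symm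
    obtain ⟨a', -, -, hNb⟩ := adj_iff_of_ncard_two (h2 b (by grind) (by grind)) avb.symm
    obtain rfl : b = b' := ((hNa b).1 hab).resolve_left (by grind)
    obtain rfl : a = a' := ((hNb a).1 hab.symm).resolve_left (by grind)
    clear h2 hu hv
    have hbc : ¬ G.graph.Adj b c := by grind
    have had : ¬ G.graph.Adj a d := by grind
    by_cases hcd : G.graph.Adj c d
    · exact hlt (G.three_le_negIndex_of_hexagon hub hud hbd aua hab.symm avb.symm avd.symm
        hcd.symm auc huv hbc (mt (hs _ _) had))
    · exact hlt (G.three_le_negIndex_of_triangular hcd (mt (hs _ _) hac) (mt (hs _ _) had)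
        auc.symm avd.symm hab (mt (hs _ _) hvc) (mt (hs _ _) hbc) (mt (hs _ _) hbd))
  have hab := key a b c d (by simp; grind) aua auc avb avd hac hbd hva hvc hub hud
  have had := key a d c b (by simp; grind) aua auc avd avb hac (mt (hs _ _) hbd) hva hvc hud hub
  have hcb := key c b a d (by simp; grind) auc aua avb avd (mt (hs _ _) hac) hbd hvc hva hub hud
  clear key
  obtain ⟨w, hwu, haw, hNa⟩ := adj_iff_of_ncard_two (h2 a (by grind) (by grind)) aua.symm
  obtain ⟨v', -, -, hNx⟩ := adj_iff_of_ncard_two (h2 x (by grind) (by grind)) aux.symm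
  obtain rfl : v = v' := ((hNx v).1 avx.symm).resolve_left (by grind)
  -- Either `w` has exactly the neighbours `a` and `c`, and `w, u, b` is triangular against `a, x,
  -- v`, or `c, a, b` is triangular against `u, w, v`.
  by_cases hcw : G.graph.Adj c w
  · have hwv : w ≠ v := by
      rintro rfl
      exact hva haw.symm
    obtain ⟨c', -, -, hNw⟩ := adj_iff_of_ncard_two (h2 w hwu hwv) haw.symm
    obtain rfl : c = c' := ((hNw c).1 hcw.symm).resolve_left (by grind)
    have hwb : ¬ G.graph.Adj w b := by grind
    have hwx : ¬ G.graph.Adj w x := by grind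
    have hwv' : ¬ G.graph.Adj w v := by grind
    have hwu' : ¬ G.graph.Adj w u := by grind
    exact hlt (G.three_le_negIndex_of_triangular hwu' hwb hub haw.symm aux avb.symm hwx hwv' huv)
  · exact hlt (G.three_le_negIndex_of_triangular (mt (hs _ _) hac) hcb hab auc.symm haw avb.symm
      hcw (mt (hs _ _) hvc) (mt (hs _ _) hva))

theorem exists_isomorphic_of_two_common (hG : G.IsBicyclic) (hlt : G.negIndex < 3)
    {u v x z c d : V} (hd : [u, v, x, z, c, d].Nodup)
    (hu : ∀ w, G.graph.Adj u w ↔ w = x ∨ w = z ∨ w = c)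
    (hv : ∀ w, G.graph.Adj v w ↔ w = x ∨ w = z ∨ w = d)
    (h2 : ∀ w, w ≠ u → w ≠ v → (G.graph.neighborSet w).ncard = 2) :
    ∃ a b c, G.Isomorphic (theta 1 1 2 a b c) := by
  have hs : ∀ x y, G.graph.Adj x y → G.graph.Adj y x := fun _ _ h => h.symm
  have hd' := hd
  simp at hd'
  have huv : ¬ G.graph.Adj u v := by grind
  have hud : ¬ G.graph.Adj u d := by grind
  have hvc : ¬ G.graph.Adj v c := by grind
  have aux : G.graph.Adj u x := by grind
  have avx : G.graph.Adj v x := by grind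
  have auz : G.graph.Adj u z := by grind
  have avz : G.graph.Adj v z := by grind
  have auc : G.graph.Adj u c := by grind
  have avd : G.graph.Adj v d := by grind
  obtain ⟨v₁, -, -, hNx⟩ := adj_iff_of_ncard_two (h2 x (by grind) (by grind)) aux.symm
  obtain ⟨v₂, -, -, hNz⟩ := adj_iff_of_ncard_two (h2 z (by grind) (by grind)) auz.symm
  obtain rfl : v = v₁ := ((hNx v).1 avx.symm).resolve_left (by grind)
  obtain rfl : v = v₂ := ((hNz v).1 avz.symm).resolve_left (by grind)
  obtain ⟨c', hcu, hcc, hNc⟩ := adj_iff_of_ncard_two (h2 c (by grind) (by grind)) auc.symm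
  obtain ⟨d', hdv, hdd, hNd⟩ := adj_iff_of_ncard_two (h2 d (by grind) (by grind)) avd.symm
  clear h2
  by_cases hcd : G.graph.Adj c d
  · exact exists_isomorphic_theta_one_one_two hG hd hu hv hNx hNz (by grind) (by grind)
  exfalso
  have hcv : c' ≠ v := by
    rintro rfl
    exact hvc hcc.symm
  have hxc : ¬ G.graph.Adj x c' := by grind
  -- A common second neighbour of `c` and `d` gives the hexagon `u x v d c' c`. Otherwise `d, x, c`
  -- is triangular against `v, u, c'`.
  by_cases h : c' = d'
  · subst h
    have hne := hcc.ne
    have huc : ¬ G.graph.Adj u c' := by grind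
    have hvc' : ¬ G.graph.Adj v c' := by grind
    have := G.three_le_negIndex_of_hexagon huv huc hvc' aux avx avd hdd.symm hcc.symm auc hud hvc
      (mt (hs _ _) hxc)
    omega
  · have hdc : ¬ G.graph.Adj d c' := by grind
    have hdx : ¬ G.graph.Adj x d := by grind
    have hcx : ¬ G.graph.Adj x c := by grind
    have := G.three_le_negIndex_of_triangular (mt (hs _ _) hdx) (mt (hs _ _) hcd) hcx avd.symm
      aux.symm hcc (mt (hs _ _) hud) hdc hxc
    omega

theorem exists_isomorphic_of_not_adj (hG : G.IsBicyclic) (hlt : G.negIndex < 3)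
    {u v : V} (hne : u ≠ v) (huv : ¬ G.graph.Adj u v)
    (hu : (G.graph.neighborSet u).ncard = 3) (hv : (G.graph.neighborSet v).ncard = 3)
    (h2 : ∀ w, w ≠ u → w ≠ v → (G.graph.neighborSet w).ncard = 2) :
    (∃ a b c, G.Isomorphic (theta 1 1 1 a b c)) ∨ ∃ a b c, G.Isomorphic (theta 1 1 2 a b c) := by
  have hvu : ¬ G.graph.Adj v u := fun h => huv h.symm
  by_cases hx : ∃ x, G.graph.Adj u x ∧ G.graph.Adj v x
  swap
  · push Not at hx
    have := three_le_negIndex_of_no_common hne huv hx hu hv h2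
    omega
  obtain ⟨x, hux, hvx⟩ := hx
  by_cases hz : ∃ z, G.graph.Adj u z ∧ G.graph.Adj v z ∧ x ≠ z
  · obtain ⟨z, huz, hvz, hxz⟩ := hz
    obtain ⟨c, hxc, hzc, hNu⟩ := adj_iff_of_ncard_three_of_adj_of_adj hu hux huz hxz
    obtain ⟨d, hxd, hzd, hNv⟩ := adj_iff_of_ncard_three_of_adj_of_adj hv hvx hvz hxz
    have huc : G.graph.Adj u c := (hNu c).2 (by simp)
    have hvd : G.graph.Adj v d := (hNv d).2 (by simp)
    have n₁ := hux.ne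
    have n₂ := hvx.ne
    have n₃ := huz.ne
    have n₄ := hvz.ne
    have n₅ := huc.ne
    have n₆ := hvd.ne
    by_cases hcd : c = d
    · subst hcd
      left
      obtain ⟨v₁, -, -, hNx⟩ := adj_iff_of_ncard_two (h2 x n₁.symm n₂.symm) hux.symm
      obtain ⟨v₂, -, -, hNz⟩ := adj_iff_of_ncard_two (h2 z n₃.symm n₄.symm) huz.symm
      obtain ⟨v₃, -, -, hNc⟩ := adj_iff_of_ncard_two (h2 c n₅.symm n₆.symm) huc.symm
      obtain rfl : v = v₁ := ((hNx v).1 hvx.symm).resolve_left hne.symm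
      obtain rfl : v = v₂ := ((hNz v).1 hvz.symm).resolve_left hne.symm
      obtain rfl : v = v₃ := ((hNc v).1 hvd.symm).resolve_left hne.symm
      exact exists_isomorphic_theta_one_one_one hG (by simp; grind) hNu hNv hNx hNz hNc
    · right
      have n₇ : u ≠ d := by
        rintro rfl
        exact hvu hvd
      have n₈ : v ≠ c := by
        rintro rfl
        exact huv huc
      exact exists_isomorphic_of_two_common hG hlt (by simp; grind) hNu hNv h2
  · exfalso
    obtain ⟨a, c, hxa, hxc, hac, hNu⟩ := adj_iff_of_ncard_three_of_adj hu hux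
    obtain ⟨b, d, hxb, hxd, hbd, hNv⟩ := adj_iff_of_ncard_three_of_adj hv hvx
    push Not at hz
    have hua : G.graph.Adj u a := (hNu a).2 (by simp)
    have huc : G.graph.Adj u c := (hNu c).2 (by simp)
    have hvb : G.graph.Adj v b := (hNv b).2 (by simp)
    have hvd : G.graph.Adj v d := (hNv d).2 (by simp)
    have hva : ¬ G.graph.Adj v a := fun h => hxa (hz a hua h)
    have hvc : ¬ G.graph.Adj v c := fun h => hxc (hz c huc h)
    have n₁ := hux.ne
    have n₂ := hvx.ne
    have n₃ := hua.ne
    have n₄ := huc.ne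
    have n₅ := hvb.ne
    have n₆ := hvd.ne
    have hd : [u, v, x, a, b, c, d].Nodup := by
      clear h2 hz
      simp
      grind
    have := three_le_negIndex_of_one_common hd hNu hNv h2
    omega

end Classification

end WeightedGraph

theorem theorem4p5 {V : Type*} [Fintype V] [DecidableEq V] (G : WeightedGraph V)
    (hG : G.IsBicyclic) (hpend : ¬ G.HasPendant) :
    G.negIndex = 2 ↔
      (∃ a₁ a₂ a₃ a₄ b₁ b₂ b₃ b₄ : PosReal,
        G.Isomorphic (WeightedGraph.infty 4 1 4 ![a₁, a₂, a₃, a₄] ![b₁, b₂, b₃, b₄] ![]) ∧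
        (a₁ : ℝ) * a₃ = a₂ * a₄ ∧ (b₁ : ℝ) * b₃ = b₂ * b₄) ∨
      (∃ a₁ a₂ b₁ b₂ c₁ c₂ : PosReal,
        G.Isomorphic (WeightedGraph.theta 1 1 1 ![a₁, a₂] ![b₁, b₂] ![c₁, c₂]) ∧
        ((a₂ : ℝ) * b₁ ≠ a₁ * b₂ ∨ (a₂ : ℝ) * c₁ ≠ a₁ * c₂)) ∨
      (∃ a₁ a₂ b₁ c₁ c₂ : PosReal,
        G.Isomorphic (WeightedGraph.theta 1 0 1 ![a₁, a₂] ![b₁] ![c₁, c₂])) ∨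
      (∃ a₁ a₂ b₁ c₁ c₂ c₃ : PosReal,
        G.Isomorphic (WeightedGraph.theta 1 0 2 ![a₁, a₂] ![b₁] ![c₁, c₂, c₃]) ∧
        (b₁ : ℝ) * c₂ ≤ c₁ * c₃) ∨
      (∃ a₁ a₂ a₃ b₁ c₁ c₂ c₃ : PosReal,
        G.Isomorphic (WeightedGraph.theta 2 0 2 ![a₁, a₂, a₃] ![b₁] ![c₁, c₂, c₃]) ∧
        (a₂ : ℝ) * b₁ * c₂ - a₁ * a₃ * c₂ - a₂ * c₁ * c₃ = 0) ∨
      (∃ a₁ a₂ b₁ b₂ c₁ c₂ c₃ : PosReal,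
        G.Isomorphic (WeightedGraph.theta 1 1 2 ![a₁, a₂] ![b₁, b₂] ![c₁, c₂, c₃]) ∧
        (a₁ : ℝ) * b₂ = a₂ * b₁) := by
  -- Rewrites a weight function on `Fin n` as the literal vector of its values, the form in which
  -- the weight conditions are stated.
  have eta {n : ℕ} (f : Fin n → PosReal) : FinVec.etaExpand f = f := FinVec.etaExpand_eq f
  constructor
  · intro h
    have hlt : G.negIndex < 3 := by omega
    rcases hG.degrees hpend with ⟨v, h4, h2⟩ | ⟨u, v, hne, hu, hv, h2⟩
    · obtain ⟨a, b, c, hi⟩ := WeightedGraph.exists_isomorphic_of_degree_four hG hlt h4 h2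
      rw [← eta a, ← eta b, ← eta c] at hi
      exact .inl ⟨_, _, _, _, _, _, _, _, hi,
        (WeightedGraph.negIndex_infty_four_one_four _ _ _ _ _ _ _ _).1 (hi.negIndex_eq ▸ h)⟩
    right
    by_cases huv : G.graph.Adj u v
    · right
      rcases WeightedGraph.exists_isomorphic_of_adj hG hlt huv hu hv h2 with
        ⟨a, b, c, hi⟩ | ⟨a, b, c, hi⟩ | ⟨a, b, c, hi⟩ <;>
        rw [← eta a, ← eta b, ← eta c] at hi
      · exact .inl ⟨_, _, _, _, _, hi⟩
      · exact .inr (.inl ⟨_, _, _, _, _, _, hi,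
          (WeightedGraph.negIndex_theta_one_zero_two _ _ _ _ _ _).1 (hi.negIndex_eq ▸ h)⟩)
      · exact .inr (.inr (.inl ⟨_, _, _, _, _, _, _, hi,
          (WeightedGraph.negIndex_theta_two_zero_two _ _ _ _ _ _ _).1 (hi.negIndex_eq ▸ h)⟩))
    · rcases WeightedGraph.exists_isomorphic_of_not_adj hG hlt hne huv hu hv h2 with
        ⟨a, b, c, hi⟩ | ⟨a, b, c, hi⟩ <;>
        rw [← eta a, ← eta b, ← eta c] at hi
      · exact .inl ⟨_, _, _, _, _, _, hi,
          (WeightedGraph.negIndex_theta_one_one_one _ _ _ _ _ _).1 (hi.negIndex_eq ▸ h)⟩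
      · exact .inr (.inr (.inr (.inr ⟨_, _, _, _, _, _, _, hi,
          (WeightedGraph.negIndex_theta_one_one_two _ _ _ _ _ _ _).1 (hi.negIndex_eq ▸ h)⟩)))
  · rintro (⟨_, _, _, _, _, _, _, _, hi, hw⟩ | ⟨_, _, _, _, _, _, hi, hw⟩ | ⟨_, _, _, _, _, hi⟩ |
      ⟨_, _, _, _, _, _, hi, hw⟩ | ⟨_, _, _, _, _, _, _, hi, hw⟩ | ⟨_, _, _, _, _, _, _, hi, hw⟩) <;>
      rw [hi.negIndex_eq]
    · exact (WeightedGraph.negIndex_infty_four_one_four _ _ _ _ _ _ _ _).2 hw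
    · exact (WeightedGraph.negIndex_theta_one_one_one _ _ _ _ _ _).2 hw
    · exact WeightedGraph.negIndex_theta_one_zero_one _ _ _ _ _
    · exact (WeightedGraph.negIndex_theta_one_zero_two _ _ _ _ _ _).2 hw
    · exact (WeightedGraph.negIndex_theta_two_zero_two _ _ _ _ _ _ _).2 hw
    · exact (WeightedGraph.negIndex_theta_one_one_two _ _ _ _ _ _ _).2 hw
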